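/- Let $A$ be an associative unital ring and let $C$ be an $A$-coring with comultiplication $\Delta(c)=c_{(1)}\otimes_A c_{(2)}$ and counit $\varepsilon$. Let $C^*=\mathrm{Hom}_A(C,A)$ be the ring of right $A$-linear functionals, with product $(f*g)(c)=f(g(c_{(1)})c_{(2)})$, and ${}^*C={}_A\mathrm{Hom}(C,A)$ the ring of left $A$-linear functionals, with product $(f*g)(c)=g(c_{(1)}f(c_{(2)}))$; $C$ is a $C^*$-${}^*C$ bimodule by $f\cdot c=f(c_{(1)})c_{(2)}$ and $c\cdot g=c_{(1)}g(c_{(2)})$. Write $\mathcal M^C$ and ${}^C\mathcal M$ for the categories of right and left $C$-comodules. Two modules are similar if each is a direct summand of a finite power of the other. A module $M$ is weakly locally projective if for every finitely generated submodule $E\subseteq M$, every map $f:M\to Y$ and every surjection $g:X\to Y$ there is a map $h:M\to X$ with $g\circ h|_E=f|_E$ (for example, $M$ projective). Let $Q$ be the group of right $A$-linear maps $q:C\to{}^*C$ with $q(x_{(1)})(c)\,x_{(2)}=c_{(1)}\,q(x)(c_{(2)})$ for all $x,c\in C$, and let $\mathbb C(C)=(C^*,{}^*C,C,Q,\triangledown,\blacktriangledown)$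 be the Morita context with $(x\,\triangledown\, q)(y)=q(y)(x)$ and $q\,\blacktriangledown\, x=q(x)$; it is strict if both maps $\triangledown:C\otimes_{{}^*C}Q\to C^*$ and $\blacktriangledown:Q\otimes_{C^*}C\to{}^*C$ are surjective. The following statements are equivalent. (0) $C$ is left and right quasi-Frobenius over the base: $C$ is a direct summand of a finite power of ${}^*C$ as a right ${}^*C$-module and a direct summand of a finite power of $C^*$ as a left $C^*$-module. (1) $C$ is weakly locally projective as a right $A$-module, and $C$ and $C^*$ are similar as left $C^*$-modules. (2) $C$ is weakly locally projective as a left $A$-module, and $C$ and ${}^*C$ are similar as right ${}^*C$-modules. (3) $C$ is finitely generated and projective as a left $A$-module, and $C$ is a finitely generated projective generator in $\mathcal M^C$. (4) $C$ is finitely generated and projective as a right $A$-module, and $C$ is a finitely generated projective generator in ${}^C\mathcal M$. (5) $C$ is finitely generated and projective as a left and as a right $A$-module, and any one of the following conditions holds (each of them gives an equivalent statement): (i) the Morita context $\mathbb C(C)$ is strict; (ii) $-\otimes_{C^*}C:\mathcal M_{C^*}\to\mathcal M^C$ is an equivalence of categories; (iii) $C$ is faithfully flat as a left $C^*$-module;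 (iv) $C\otimes_{{}^*C}-:{}_{{}^*C}\mathcal M\to{}^C\mathcal M$ is an equivalence of categories; (v) $C$ is faithfully flat as a right ${}^*C$-module. Moreover, in case (5)(i) the functor $-\otimes_{C^*}C:\mathcal M_{C^*}\to\mathcal M_{{}^*C}$ is an equivalence of categories. -/

import Mathlib

universe u v

set_option linter.unusedSectionVars false

open CategoryTheory MulOpposite

noncomputable section

namespace CoringTheory

/-! ### The tensor product of a right module and a left module over a noncommutative ring

Right `R`-modules are modules over `Rᵐᵒᵖ`, and `op r • m` is the product `m r`. -/

section BalancedTensor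

/-- The subgroup of `M ⊗[ℤ] N` generated by all `m r ⊗ n - m ⊗ r n`. -/
def balancedRel (R M N : Type u) [Ring R] [AddCommGroup M] [AddCommGroup N] [Module Rᵐᵒᵖ M]
    [Module R N] : AddSubgroup (TensorProduct ℤ M N) :=
  AddSubgroup.closure
    {t | ∃ (m : M) (r : R) (n : N), t = (op r • m) ⊗ₜ[ℤ] n - m ⊗ₜ[ℤ] (r • n)}

/-- `BT R M N` is the abelian group `M ⊗_R N`, for a right `R`-module `M` and a left `R`-module
`N` over an arbitrary ring `R`. -/
def BT (R M N : Type u) [Ring R] [AddCommGroup M] [AddCommGroup N] [Module Rᵐᵒᵖ M]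
    [Module R N] : Type u :=
  TensorProduct ℤ M N ⧸ balancedRel R M N

namespace BT

variable {R M N P M' N' P' S : Type u} [Ring R] [AddCommGroup M] [AddCommGroup N]
  [Module Rᵐᵒᵖ M] [Module R N] [AddCommGroup M'] [AddCommGroup N'] [Module Rᵐᵒᵖ M'] [Module R N']
  [AddCommGroup P] [AddCommGroup P'] [Ring S]

instance : AddCommGroup (BT R M N) :=
  inferInstanceAs (AddCommGroup (TensorProduct ℤ M N ⧸ balancedRel R M N))

variable (R) in
/-- The pure tensor `m ⊗ n` in `M ⊗_R N`. -/
def tmul (m : M) (n : N) : BT R M N :=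
  QuotientAddGroup.mk' (balancedRel R M N) (m ⊗ₜ[ℤ] n)

lemma add_tmul (m m' : M) (n : N) : tmul R (m + m') n = tmul R m n + tmul R m' n :=
  congrArg (QuotientAddGroup.mk' (balancedRel R M N)) (TensorProduct.add_tmul m m' n)

lemma tmul_add (m : M) (n n' : N) : tmul R m (n + n') = tmul R m n + tmul R m n' :=
  congrArg (QuotientAddGroup.mk' (balancedRel R M N)) (TensorProduct.tmul_add m n n')

lemma smul_tmul (m : M) (r : R) (n : N) : tmul R (op r • m) n = tmul R m (r • n) := by
  refine (QuotientAddGroup.eq_iff_sub_mem (N := balancedRel R M N)).2 ?_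
  exact AddSubgroup.subset_closure ⟨m, r, n, rfl⟩

lemma zero_tmul (n : N) : tmul R (0 : M) n = 0 :=
  congrArg (QuotientAddGroup.mk' (balancedRel R M N)) (TensorProduct.zero_tmul M n)

lemma tmul_zero (m : M) : tmul R m (0 : N) = 0 :=
  congrArg (QuotientAddGroup.mk' (balancedRel R M N)) (TensorProduct.tmul_zero N m)

lemma induction {p : BT R M N → Prop} (t : BT R M N) (h0 : p 0)
    (ht : ∀ m n, p (tmul R m n)) (ha : ∀ x y, p x → p y → p (x + y)) : p t := by
  obtain ⟨t, rfl⟩ := QuotientAddGroup.mk'_surjective _ t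
  induction t using TensorProduct.induction_on with
  | zero => rw [map_zero]; exact h0
  | tmul m n => exact ht m n
  | add x y hx hy => rw [map_add]; exact ha _ _ hx hy

/-- The universal property of `M ⊗_R N`: additive maps out of it are balanced biadditive maps. -/
def lift {G : Type v} [AddCommGroup G] (f : M →+ N →+ G)
    (hf : ∀ (m : M) (r : R) (n : N), f (op r • m) n = f m (r • n)) : BT R M N →+ G :=
  QuotientAddGroup.lift (balancedRel R M N)
    (TensorProduct.liftAddHom f (fun r m n => by simp)) (by
      rw [balancedRel, AddSubgroup.closure_le]
      rintro _ ⟨m, r, n, rfl⟩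
      simp [AddMonoidHom.mem_ker, hf])

@[simp] lemma lift_tmul {G : Type v} [AddCommGroup G] (f : M →+ N →+ G)
    (hf : ∀ (m : M) (r : R) (n : N), f (op r • m) n = f m (r • n)) (m : M) (n : N) :
    lift f hf (tmul R m n) = f m n := by
  rfl

/-- `lift` for a function of two variables. -/
def lift₂ {G : Type v} [AddCommGroup G] (f : M → N → G)
    (h1 : ∀ m m' n, f (m + m') n = f m n + f m' n) (h2 : ∀ m n n', f m (n + n') = f m n + f m n')
    (h3 : ∀ (m : M) (r : R) (n : N), f (op r • m) n = f m (r • n)) : BT R M N →+ G :=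
  lift (AddMonoidHom.mk' (fun m => AddMonoidHom.mk' (f m) (h2 m))
    (fun m m' => by ext n; exact h1 m m' n)) h3

@[simp] lemma lift₂_tmul {G : Type v} [AddCommGroup G] (f : M → N → G)
    (h1 : ∀ m m' n, f (m + m') n = f m n + f m' n) (h2 : ∀ m n n', f m (n + n') = f m n + f m n')
    (h3 : ∀ (m : M) (r : R) (n : N), f (op r • m) n = f m (r • n)) (m : M) (n : N) :
    lift₂ f h1 h2 h3 (tmul R m n) = f m n := by
  rfl

/-- The map `f ⊗ g : M ⊗_R N → M' ⊗_R N'`. -/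
def map (f : M →ₗ[Rᵐᵒᵖ] M') (g : N →ₗ[R] N') : BT R M N →+ BT R M' N' :=
  lift₂ (fun m n => tmul R (f m) (g n)) (fun m m' n => by rw [map_add, add_tmul])
    (fun m n n' => by rw [map_add, tmul_add])
    (fun m r n => by rw [map_smul, map_smul, smul_tmul])

@[simp] lemma map_tmul (f : M →ₗ[Rᵐᵒᵖ] M') (g : N →ₗ[R] N') (m : M) (n : N) :
    map f g (tmul R m n) = tmul R (f m) (g n) := by
  rfl

/-- If `M` is an `S`-`R` bimodule, then `M ⊗_R N` is a left `S`-module: `s (m ⊗ n) = s m ⊗ n`. -/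
instance leftModule [Module S M] [SMulCommClass S Rᵐᵒᵖ M] : Module S (BT R M N) where
  smul s := map (Module.toModuleEnd Rᵐᵒᵖ M s) LinearMap.id
  one_smul t := by
    change map _ _ t = t
    induction t using induction with
    | h0 => simp
    | ht m n => simp
    | ha x y hx hy => rw [map_add, hx, hy]
  mul_smul s s' t := by
    change map _ _ t = map _ _ (map _ _ t)
    induction t using induction with
    | h0 => simp
    | ht m n => simp [mul_smul]
    | ha x y hx hy => simp only [map_add, hx, hy]
  smul_zero s := map_zero _
  smul_add s := map_add _
  add_smul s s' t := by
    change map _ _ t = map _ _ t + map _ _ t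
    induction t using induction with
    | h0 => simp
    | ht m n => simp [add_smul, add_tmul]
    | ha x y hx hy =>
      rw [AddMonoidHom.map_add, hx, hy, AddMonoidHom.map_add, AddMonoidHom.map_add]; abel
  zero_smul t := by
    change map _ _ t = 0
    induction t using induction with
    | h0 => simp
    | ht m n => simp [zero_tmul]
    | ha x y hx hy => simp only [map_add, hx, hy, add_zero]

/-- If `N` is an `R`-`S` bimodule, then `M ⊗_R N` is a right `S`-module: `(m ⊗ n) s = m ⊗ n s`. -/
instance rightModule [Module Sᵐᵒᵖ N] [SMulCommClass R Sᵐᵒᵖ N] : Module Sᵐᵒᵖ (BT R M N) where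
  smul s := map LinearMap.id (@Module.toModuleEnd R Sᵐᵒᵖ N _ _ _ _ _ (SMulCommClass.symm _ _ _) s)
  one_smul t := by
    change map _ _ t = t
    induction t using induction with
    | h0 => simp
    | ht m n => simp
    | ha x y hx hy => rw [map_add, hx, hy]
  mul_smul s s' t := by
    change map _ _ t = map _ _ (map _ _ t)
    induction t using induction with
    | h0 => simp
    | ht m n => simp [mul_smul]
    | ha x y hx hy => simp only [map_add, hx, hy]
  smul_zero s := map_zero _
  smul_add s := map_add _
  add_smul s s' t := by
    change map _ _ t = map _ _ t + map _ _ t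
    induction t using induction with
    | h0 => simp
    | ht m n => simp [add_smul, tmul_add]
    | ha x y hx hy =>
      rw [AddMonoidHom.map_add, hx, hy, AddMonoidHom.map_add, AddMonoidHom.map_add]; abel
  zero_smul t := by
    change map _ _ t = 0
    induction t using induction with
    | h0 => simp
    | ht m n => simp [tmul_zero]
    | ha x y hx hy => simp only [map_add, hx, hy, add_zero]

lemma smul_left_tmul [Module S M] [SMulCommClass S Rᵐᵒᵖ M] (s : S) (m : M) (n : N) :
    s • tmul R m n = tmul R (s • m) n := by
  rfl

lemma smul_right_tmul [Module Sᵐᵒᵖ N] [SMulCommClass R Sᵐᵒᵖ N] (s : Sᵐᵒᵖ) (m : M) (n : N) :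
    s • tmul R m n = tmul R m (s • n) := by
  rfl

section Assoc

variable {T : Type u} [Ring T] [Module T N] [Module Sᵐᵒᵖ N] [SMulCommClass R Sᵐᵒᵖ N] [Module S P]

/-- The canonical map `m ⊗ (n ⊗ p) ↦ (m ⊗ n) ⊗ p`. -/
def assocInv : BT R M (BT S N P) →+ BT S (BT R M N) P :=
  lift (AddMonoidHom.mk'
      (fun m => lift₂ (fun n p => tmul S (tmul R m n) p)
        (fun n n' p => by rw [tmul_add, add_tmul]) (fun n p p' => by rw [tmul_add])
        (fun n s p => by rw [← smul_right_tmul, smul_tmul]))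
      (fun m m' => by
        ext t
        induction t using induction with
        | h0 => simp
        | ht n p => simp [add_tmul]
        | ha x y hx hy => simp only [map_add, hx, hy]))
    (fun m r t => by
      induction t using induction with
      | h0 => simp
      | ht n p => simp [smul_left_tmul, smul_tmul]
      | ha x y hx hy => simp only [map_add, smul_add, hx, hy])

/-- The canonical map `(m ⊗ n) ⊗ p ↦ m ⊗ (n ⊗ p)`. -/
def assoc : BT S (BT R M N) P →+ BT R M (BT S N P) :=
  lift (AddMonoidHom.flip (AddMonoidHom.mk'
      (fun p => lift₂ (fun m n => tmul R m (tmul S n p))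
        (fun m m' n => by rw [add_tmul]) (fun m n n' => by rw [add_tmul, tmul_add])
        (fun m r n => by rw [smul_tmul, smul_left_tmul]))
      (fun p p' => by
        ext t
        induction t using induction with
        | h0 => simp
        | ht n p => simp [tmul_add]
        | ha x y hx hy => simp only [map_add, hx, hy])))
    (fun t s p => by
      induction t using induction with
      | h0 => simp
      | ht m n => simp [smul_right_tmul, smul_tmul]
      | ha x y hx hy => simp only [map_add, smul_add, AddMonoidHom.add_apply, hx, hy])

@[simp] lemma assocInv_tmul (m : M) (n : N) (p : P) :
    assocInv (tmul R m (tmul S n p)) = tmul S (tmul R m n) p := by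
  rfl

@[simp] lemma assoc_tmul (m : M) (n : N) (p : P) :
    assoc (tmul S (tmul R m n) p) = tmul R m (tmul S n p) := by
  rfl

lemma assoc_assocInv (t : BT R M (BT S N P)) : assoc (assocInv t) = t := by
  induction t using induction with
  | h0 => simp
  | ht m t =>
    induction t using induction with
    | h0 => simp [tmul_zero]
    | ht n p => rfl
    | ha x y hx hy => rw [tmul_add, map_add, map_add, hx, hy]
  | ha x y hx hy => rw [map_add, map_add, hx, hy]

lemma assocInv_assoc (t : BT S (BT R M N) P) : assocInv (assoc t) = t := by
  induction t using induction with
  | h0 => simp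
  | ht t p =>
    induction t using induction with
    | h0 => simp [zero_tmul]
    | ht m n => rfl
    | ha x y hx hy => rw [add_tmul, map_add, map_add, hx, hy]
  | ha x y hx hy => rw [map_add, map_add, hx, hy]

end Assoc


section Contract

/-- For a right linear functional `f : M → R`, the map `M ⊗_R N → N`, `m ⊗ n ↦ f(m) n`. -/
def lsmul (f : M →ₗ[Rᵐᵒᵖ] R) : BT R M N →+ N :=
  lift₂ (fun m n => f m • n) (fun m m' n => by rw [map_add, add_smul])
    (fun m n n' => by rw [smul_add])
    (fun m r n => by rw [map_smul, op_smul_eq_mul, mul_smul])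

/-- For a left linear functional `f : N → R`, the map `M ⊗_R N → M`, `m ⊗ n ↦ m f(n)`. -/
def rsmul (f : N →ₗ[R] R) : BT R M N →+ M :=
  lift₂ (fun m n => op (f n) • m) (fun m m' n => by rw [smul_add])
    (fun m n n' => by rw [map_add, MulOpposite.op_add, add_smul])
    (fun m r n => by rw [map_smul, smul_eq_mul, op_mul, mul_smul])

@[simp] lemma lsmul_tmul (f : M →ₗ[Rᵐᵒᵖ] R) (m : M) (n : N) :
    lsmul f (tmul R m n) = f m • n := by
  rfl

@[simp] lemma rsmul_tmul (f : N →ₗ[R] R) (m : M) (n : N) :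
    rsmul f (tmul R m n) = op (f n) • m := by
  rfl

lemma lsmul_op_smul [Module Sᵐᵒᵖ N] [SMulCommClass R Sᵐᵒᵖ N] (f : M →ₗ[Rᵐᵒᵖ] R) (s : Sᵐᵒᵖ)
    (t : BT R M N) : lsmul f (s • t) = s • lsmul f t := by
  induction t using induction with
  | h0 => simp
  | ht m n => rw [smul_right_tmul, lsmul_tmul, lsmul_tmul, smul_comm]
  | ha x y hx hy => rw [smul_add, map_add, hx, hy, map_add, smul_add]

lemma rsmul_smul [Module S M] [SMulCommClass S Rᵐᵒᵖ M] (f : N →ₗ[R] R) (s : S)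
    (t : BT R M N) : rsmul f (s • t) = s • rsmul f t := by
  induction t using induction with
  | h0 => simp
  | ht m n => exact (smul_comm s (op (f n)) m).symm
  | ha x y hx hy => rw [smul_add, map_add, hx, hy, map_add, smul_add]

end Contract

end BT

end BalancedTensor

/-! ### Corings -/

/-- An `A`-coring: an `A`-bimodule `C` with a coassociative and counital comultiplication
`Δ : C → C ⊗_A C` and counit `ε : C → A`, both of them maps of `A`-bimodules. -/
class Coring (A C : Type u) [Ring A] [AddCommGroup C] [Module A C] [Module Aᵐᵒᵖ C]
    [SMulCommClass A Aᵐᵒᵖ C] where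
  comul : C →+ BT A C C
  comul_smul : ∀ (a : A) (c : C), comul (a • c) = a • comul c
  comul_op_smul : ∀ (a : Aᵐᵒᵖ) (c : C), comul (a • c) = a • comul c
  counit : C →+ A
  counit_smul : ∀ (a : A) (c : C), counit (a • c) = a • counit c
  counit_op_smul : ∀ (a : Aᵐᵒᵖ) (c : C), counit (a • c) = a • counit c
  coassoc : ∀ c : C,
    BT.map (R := A) { comul with map_smul' := comul_op_smul } (LinearMap.id (R := A) (M := C))
        (comul c) =
      BT.assocInv (BT.map (R := A) (LinearMap.id (R := Aᵐᵒᵖ) (M := C))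
        { comul with map_smul' := comul_smul } (comul c))
  counit_comul : ∀ c : C,
    BT.lsmul (R := A) { counit with map_smul' := counit_op_smul } (comul c) = c
  comul_counit : ∀ c : C,
    BT.rsmul (R := A) { counit with map_smul' := counit_smul } (comul c) = c

section Duals

variable (A C : Type u) [Ring A] [AddCommGroup C] [Module A C] [Module Aᵐᵒᵖ C]
    [SMulCommClass A Aᵐᵒᵖ C]

/-- The right dual `C* = Hom_A(C, A)` (right `A`-linear maps). -/
def RightDual : Type u := C →ₗ[Aᵐᵒᵖ] A

/-- The left dual `*C = _A Hom(C, A)` (left `A`-linear maps). -/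
def LeftDual : Type u := C →ₗ[A] A

instance : AddCommGroup (RightDual A C) := inferInstanceAs (AddCommGroup (C →ₗ[Aᵐᵒᵖ] A))

instance : AddCommGroup (LeftDual A C) := inferInstanceAs (AddCommGroup (C →ₗ[A] A))

variable {A C}

namespace RightDual

/-- The underlying linear map. -/
def lin (f : RightDual A C) : C →ₗ[Aᵐᵒᵖ] A := f

@[ext] lemma ext {f g : RightDual A C} (h : ∀ c, f.lin c = g.lin c) : f = g := LinearMap.ext h

@[simp] lemma add_lin (f g : RightDual A C) (c : C) : (f + g).lin c = f.lin c + g.lin c := rfl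

@[simp] lemma zero_lin (c : C) : (0 : RightDual A C).lin c = 0 := rfl

end RightDual

namespace LeftDual

/-- The underlying linear map. -/
def lin (f : LeftDual A C) : C →ₗ[A] A := f

@[ext] lemma ext {f g : LeftDual A C} (h : ∀ c, f.lin c = g.lin c) : f = g := LinearMap.ext h

@[simp] lemma add_lin (f g : LeftDual A C) (c : C) : (f + g).lin c = f.lin c + g.lin c := rfl

@[simp] lemma zero_lin (c : C) : (0 : LeftDual A C).lin c = 0 := rfl

end LeftDual

namespace Coring

variable [Coring A C]

variable (A C) in
/-- The comultiplication as a left linear map. -/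
def comulL : C →ₗ[A] BT A C C := { comul with map_smul' := comul_smul }

variable (A C) in
/-- The comultiplication as a right linear map. -/
def comulR : C →ₗ[Aᵐᵒᵖ] BT A C C := { comul with map_smul' := comul_op_smul }

variable (A C) in
/-- The counit as an element of the left dual. -/
def counitL : LeftDual A C := ({ counit with map_smul' := counit_smul } : C →ₗ[A] A)

variable (A C) in
/-- The counit as an element of the right dual. -/
def counitR : RightDual A C := ({ counit with map_smul' := counit_op_smul } : C →ₗ[Aᵐᵒᵖ] A)

lemma coassoc' (c : C) : BT.map (comulR A C) LinearMap.id (comulR A C c) =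
    BT.assocInv (BT.map LinearMap.id (comulL A C) (comulR A C c)) :=
  coassoc c

lemma comulL_eq (c : C) : comulL A C c = comulR A C c := rfl

/-- The left action of the right dual on the coring, `f · c = f(c₁) c₂`, as a right linear map. -/
def lact (f : RightDual A C) : C →ₗ[Aᵐᵒᵖ] C where
  toFun c := BT.lsmul f.lin (comulR A C c)
  map_add' c c' := by rw [map_add, map_add]
  map_smul' a c := by rw [map_smul, BT.lsmul_op_smul, RingHom.id_apply]

/-- The right action of the left dual on the coring, `c · f = c₁ f(c₂)`, as a left linear map. -/
def ract (f : LeftDual A C) : C →ₗ[A] C where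
  toFun c := BT.rsmul f.lin (comulL A C c)
  map_add' c c' := by rw [map_add, map_add]
  map_smul' a c := by rw [map_smul, BT.rsmul_smul, RingHom.id_apply]

/-- The product `(f * g)(c) = f(g(c₁) c₂)` of the right dual. -/
def mulR (f g : RightDual A C) : RightDual A C := f.lin.comp (lact g)

/-- The product `(f * g)(c) = g(c₁ f(c₂))` of the left dual. -/
def mulL (f g : LeftDual A C) : LeftDual A C := g.lin.comp (ract f)

lemma lact_add_left (f g : RightDual A C) (c : C) : lact (f + g) c = lact f c + lact g c := by
  change BT.lsmul _ (comulR A C c) = BT.lsmul _ (comulR A C c) + BT.lsmul _ (comulR A C c)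
  induction comulR A C c using BT.induction with
  | h0 => simp
  | ht x y => simp [add_smul]
  | ha x y hx hy => simp only [map_add, hx, hy]; abel

lemma ract_add_left (f g : LeftDual A C) (c : C) : ract (f + g) c = ract f c + ract g c := by
  change BT.rsmul _ (comulL A C c) = BT.rsmul _ (comulL A C c) + BT.rsmul _ (comulL A C c)
  induction comulL A C c using BT.induction with
  | h0 => simp
  | ht x y => simp [add_smul]
  | ha x y hx hy => simp only [map_add, hx, hy]; abel

lemma lact_counit (c : C) : lact (counitR A C) c = c := counit_comul c

lemma ract_counit (c : C) : ract (counitL A C) c = c := comul_counit c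

/-- `Δ(f · c) = f · c₁ ⊗ c₂`. -/
lemma comul_lact (f : RightDual A C) (c : C) :
    comulR A C (lact f c) = BT.map (lact f) LinearMap.id (comulR A C c) := by
  have h1 : ∀ t : BT A C C, BT.map (lact f) (LinearMap.id (R := A) (M := C)) t =
      BT.map ({ BT.lsmul f.lin with map_smul' := BT.lsmul_op_smul f.lin } :
        BT A C C →ₗ[Aᵐᵒᵖ] C) LinearMap.id (BT.map (comulR A C) LinearMap.id t) := by
    intro t
    induction t using BT.induction with
    | h0 => simp
    | ht x y => rfl
    | ha x y hx hy => simp only [map_add, hx, hy]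
  have h2 : ∀ (x : C) (t : BT A C C),
      BT.map ({ BT.lsmul f.lin with map_smul' := BT.lsmul_op_smul f.lin } :
        BT A C C →ₗ[Aᵐᵒᵖ] C) LinearMap.id (BT.assocInv (BT.tmul A x t)) = f.lin x • t := by
    intro x t
    induction t using BT.induction with
    | h0 => simp [BT.tmul_zero]
    | ht u v => rfl
    | ha u v hu hv => simp only [BT.tmul_add, map_add, hu, hv, smul_add]
  rw [h1, coassoc']
  change comulR A C (BT.lsmul f.lin (comulR A C c)) = _
  induction comulR A C c using BT.induction with
  | h0 => simp
  | ht x y =>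
    rw [BT.map_tmul, h2, BT.lsmul_tmul, ← comulL_eq, map_smul]
    rfl
  | ha x y hx hy => simp only [map_add, hx, hy]

/-- `Δ(c · f) = c₁ ⊗ c₂ · f`. -/
lemma comul_ract (f : LeftDual A C) (c : C) :
    comulL A C (ract f c) = BT.map LinearMap.id (ract f) (comulL A C c) := by
  have h1 : ∀ t : BT A C C, BT.map (LinearMap.id (R := Aᵐᵒᵖ) (M := C)) (ract f) t =
      BT.map LinearMap.id ({ BT.rsmul f.lin with map_smul' := BT.rsmul_smul f.lin } :
        BT A C C →ₗ[A] C) (BT.assoc (BT.assocInv (BT.map LinearMap.id (comulL A C) t))) := by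
    intro t
    induction t using BT.induction with
    | h0 => simp
    | ht x y =>
      rw [BT.map_tmul, BT.map_tmul]
      change BT.tmul A x (BT.rsmul f.lin (comulL A C y)) = _
      induction comulL A C y using BT.induction with
      | h0 => simp [BT.tmul_zero]
      | ht u v => rfl
      | ha u v hu hv => simp only [BT.tmul_add, map_add, hu, hv]
    | ha x y hx hy => simp only [map_add, hx, hy]
  have h2 : ∀ (y : C) (t : BT A C C),
      BT.map LinearMap.id ({ BT.rsmul f.lin with map_smul' := BT.rsmul_smul f.lin } :
        BT A C C →ₗ[A] C) (BT.assoc (BT.tmul A t y)) = op (f.lin y) • t := by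
    intro x t
    induction t using BT.induction with
    | h0 => simp [BT.zero_tmul]
    | ht u v => rfl
    | ha u v hu hv => simp only [BT.add_tmul, map_add, hu, hv, smul_add]
  rw [h1, comulL_eq c, ← coassoc']
  change comulR A C (BT.rsmul f.lin (comulR A C c)) = _
  induction comulR A C c using BT.induction with
  | h0 => simp
  | ht x y =>
    rw [BT.map_tmul, BT.rsmul_tmul, map_smul, LinearMap.id_apply, h2]
  | ha x y hx hy => simp only [map_add, hx, hy]

lemma lact_mulR (f g : RightDual A C) (c : C) : lact (mulR f g) c = lact f (lact g c) := by
  change BT.lsmul _ (comulR A C c) = BT.lsmul _ (comulR A C (lact g c))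
  rw [comul_lact]
  induction comulR A C c using BT.induction with
  | h0 => simp
  | ht x y => rfl
  | ha x y hx hy => simp only [map_add, hx, hy]

lemma ract_mulL (f g : LeftDual A C) (c : C) : ract (mulL f g) c = ract g (ract f c) := by
  change BT.rsmul _ (comulL A C c) = BT.rsmul _ (comulL A C (ract f c))
  rw [comul_ract]
  induction comulL A C c using BT.induction with
  | h0 => simp
  | ht x y => rfl
  | ha x y hx hy => simp only [map_add, hx, hy]

lemma counit_lact (f : RightDual A C) (c : C) : (counitR A C).lin (lact f c) = f.lin c := by
  conv_rhs => rw [← ract_counit (A := A) c]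
  change (counitR A C).lin (BT.lsmul _ (comulL A C c)) = f.lin (BT.rsmul _ (comulL A C c))
  induction comulL A C c using BT.induction with
  | h0 => simp
  | ht x y =>
    exact ((counitL A C).lin.map_smul (f.lin x) y).trans
      (f.lin.map_smul (op ((counitL A C).lin y)) x).symm
  | ha x y hx hy => simp only [map_add, hx, hy]

lemma counit_ract (f : LeftDual A C) (c : C) : (counitL A C).lin (ract f c) = f.lin c := by
  conv_rhs => rw [← lact_counit (A := A) c]
  change (counitL A C).lin (BT.rsmul _ (comulL A C c)) = f.lin (BT.lsmul _ (comulL A C c))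
  induction comulL A C c using BT.induction with
  | h0 => simp
  | ht x y =>
    exact ((counitR A C).lin.map_smul (op (f.lin y)) x).trans
      (f.lin.map_smul ((counitR A C).lin x) y).symm
  | ha x y hx hy => simp only [map_add, hx, hy]

/-- The ring `C*`, with product `(f * g)(c) = f(g(c₁) c₂)` and unit `ε`. -/
instance : Ring (RightDual A C) :=
  { (inferInstance : AddCommGroup (RightDual A C)) with
    mul := mulR
    one := counitR A C
    mul_assoc := fun f g h => RightDual.ext fun c => by
      change f.lin (lact g (lact h c)) = f.lin (lact (mulR g h) c)
      rw [lact_mulR]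
    one_mul := fun f => RightDual.ext fun c => counit_lact f c
    mul_one := fun f => RightDual.ext fun c => congrArg f.lin (lact_counit c)
    zero_mul := fun f => rfl
    mul_zero := fun f => RightDual.ext fun c => by
      change f.lin (lact 0 c) = 0
      have h := lact_add_left (0 : RightDual A C) 0 c
      rw [add_zero, left_eq_add] at h
      rw [h, map_zero]
    left_distrib := fun f g h => RightDual.ext fun c => by
      change f.lin (lact (g + h) c) = f.lin (lact g c) + f.lin (lact h c)
      rw [lact_add_left, map_add]
    right_distrib := fun f g h => rfl }

/-- The ring `*C`, with product `(f * g)(c) = g(c₁ f(c₂))` and unit `ε`. -/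
instance : Ring (LeftDual A C) :=
  { (inferInstance : AddCommGroup (LeftDual A C)) with
    mul := mulL
    one := counitL A C
    mul_assoc := fun f g h => LeftDual.ext fun c => by
      change h.lin (ract (mulL f g) c) = h.lin (ract g (ract f c))
      rw [ract_mulL]
    one_mul := fun f => LeftDual.ext fun c => congrArg f.lin (ract_counit c)
    mul_one := fun f => LeftDual.ext fun c => counit_ract f c
    mul_zero := fun f => rfl
    zero_mul := fun f => LeftDual.ext fun c => by
      change f.lin (ract 0 c) = 0
      have h := ract_add_left (0 : LeftDual A C) 0 c
      rw [add_zero, left_eq_add] at h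
      rw [h, map_zero]
    right_distrib := fun f g h => LeftDual.ext fun c => by
      change h.lin (ract (f + g) c) = h.lin (ract f c) + h.lin (ract g c)
      rw [ract_add_left, map_add]
    left_distrib := fun f g h => rfl }

/-- `C` is a left `C*`-module by `f · c = f(c₁) c₂`. -/
instance leftModule : Module (RightDual A C) C where
  smul f c := lact f c
  one_smul c := lact_counit (A := A) c
  mul_smul f g c := lact_mulR f g c
  smul_zero f := map_zero (lact f)
  smul_add f := map_add (lact f)
  add_smul f g c := lact_add_left f g c
  zero_smul c := by
    change lact (0 : RightDual A C) c = 0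
    have h := lact_add_left (0 : RightDual A C) 0 c
    rwa [add_zero, left_eq_add] at h

/-- `C` is a right `*C`-module by `c · f = c₁ f(c₂)`. -/
instance rightModule : Module (LeftDual A C)ᵐᵒᵖ C where
  smul f c := ract f.unop c
  one_smul c := ract_counit (A := A) c
  mul_smul f g c := ract_mulL g.unop f.unop c
  smul_zero f := map_zero (ract f.unop)
  smul_add f := map_add (ract f.unop)
  add_smul f g c := ract_add_left f.unop g.unop c
  zero_smul c := by
    change ract (0 : LeftDual A C) c = 0
    have h := ract_add_left (0 : LeftDual A C) 0 c
    rwa [add_zero, left_eq_add] at h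

lemma smul_def (f : RightDual A C) (c : C) : f • c = BT.lsmul f.lin (comul (A := A) c) := rfl

lemma op_smul_def (f : LeftDual A C) (c : C) :
    op f • c = BT.rsmul f.lin (comul (A := A) c) := rfl

instance smulComm₁ : SMulCommClass (RightDual A C) Aᵐᵒᵖ C where
  smul_comm f a c := (lact f).map_smul a c

instance smulComm₂ : SMulCommClass A (LeftDual A C)ᵐᵒᵖ C where
  smul_comm a f c := ((ract f.unop).map_smul a c).symm

instance smulComm₃ : SMulCommClass (RightDual A C) (LeftDual A C)ᵐᵒᵖ C where
  smul_comm f g c := by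
    change lact f (BT.rsmul g.unop.lin (comulL A C c)) =
      BT.rsmul g.unop.lin (comulR A C (lact f c))
    rw [comul_lact, comulL_eq]
    induction comulR A C c using BT.induction with
    | h0 => simp
    | ht x y => exact (lact f).map_smul _ _
    | ha x y hx hy => simp only [map_add, hx, hy]

end Coring

end Duals

/-! ### Morita contexts -/

/-- A Morita context `(R, S, P, Q, μ, τ)`: bimodules `_R P_S` and `_S Q_R`, bimodule maps
`μ : P ⊗_S Q → R` and `τ : Q ⊗_R P → S` with `μ(p ⊗ q) p' = p τ(q ⊗ p')` and
`τ(q ⊗ p) q' = q μ(p ⊗ q')`. -/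
structure MoritaContext (R S P Q : Type u) [Ring R] [Ring S] [AddCommGroup P] [AddCommGroup Q]
    [Module R P] [Module Sᵐᵒᵖ P] [SMulCommClass R Sᵐᵒᵖ P]
    [Module S Q] [Module Rᵐᵒᵖ Q] [SMulCommClass S Rᵐᵒᵖ Q] where
  μ : BT S P Q →+ R
  τ : BT R Q P →+ S
  μ_smul : ∀ (r : R) t, μ (r • t) = r • μ t
  μ_op_smul : ∀ (r : Rᵐᵒᵖ) t, μ (r • t) = r • μ t
  τ_smul : ∀ (s : S) t, τ (s • t) = s • τ t
  τ_op_smul : ∀ (s : Sᵐᵒᵖ) t, τ (s • t) = s • τ t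
  μ_τ : ∀ (p : P) (q : Q) (p' : P), μ (BT.tmul S p q) • p' = op (τ (BT.tmul R q p')) • p
  τ_μ : ∀ (q : Q) (p : P) (q' : Q), τ (BT.tmul R q p) • q' = op (μ (BT.tmul S p q')) • q

/-- A Morita context is strict if both of its maps are surjective. -/
def MoritaContext.Strict {R S P Q : Type u} [Ring R] [Ring S] [AddCommGroup P] [AddCommGroup Q]
    [Module R P] [Module Sᵐᵒᵖ P] [SMulCommClass R Sᵐᵒᵖ P]
    [Module S Q] [Module Rᵐᵒᵖ Q] [SMulCommClass S Rᵐᵒᵖ Q] (K : MoritaContext R S P Q) : Prop :=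
  Function.Surjective K.μ ∧ Function.Surjective K.τ

section CoringContext

variable (A C : Type u) [Ring A] [AddCommGroup C] [Module A C] [Module Aᵐᵒᵖ C]
    [SMulCommClass A Aᵐᵒᵖ C]

/-- `*C` is a right `A`-module by `(f a)(c) = f(c) a`. -/
instance : Module Aᵐᵒᵖ (LeftDual A C) := inferInstanceAs (Module Aᵐᵒᵖ (C →ₗ[A] A))

variable {A C} in
@[simp] lemma LeftDual.op_smul_lin (a : Aᵐᵒᵖ) (f : LeftDual A C) (c : C) :
    (a • f).lin c = a • f.lin c := rfl

variable {A C} in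
/-- For a right `A`-linear map `q : C → *C` and `c ∈ C`, the element `x ↦ q(x)(c)` of `C*`. -/
def evalQ (q : C →ₗ[Aᵐᵒᵖ] LeftDual A C) (c : C) : RightDual A C :=
  ({ toFun := fun x => (q x).lin c
     map_add' := fun x y => by rw [map_add, LeftDual.add_lin]
     map_smul' := fun a x => by rw [map_smul, LeftDual.op_smul_lin, RingHom.id_apply] } :
    C →ₗ[Aᵐᵒᵖ] A)

variable {A C} in
@[simp] lemma evalQ_lin (q : C →ₗ[Aᵐᵒᵖ] LeftDual A C) (c x : C) :
    (evalQ q c).lin x = (q x).lin c := rfl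

variable [Coring A C]

open Coring

/-- The group `Q` of all right `A`-linear maps `q : C → *C` with
`q(x₁)(c) x₂ = c₁ q(x)(c₂)` for all `x, c ∈ C`. -/
def moritaQ : AddSubgroup (C →ₗ[Aᵐᵒᵖ] LeftDual A C) where
  carrier := {q | ∀ x c : C, BT.lsmul (evalQ q c).lin (comul (A := A) x) =
    BT.rsmul (q x).lin (comul (A := A) c)}
  zero_mem' := fun x c =>
    (zero_smul (RightDual A C) x).trans (zero_smul (LeftDual A C)ᵐᵒᵖ c).symm
  add_mem' := fun {p q} hp hq x c =>
    (lact_add_left (evalQ p c) (evalQ q c) x).trans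
      ((congrArg₂ (· + ·) (hp x c) (hq x c)).trans (ract_add_left (p x) (q x) c).symm)
  neg_mem' := fun {p} hp x c =>
    (neg_smul (evalQ p c) x).trans
      ((congrArg Neg.neg (hp x c)).trans (neg_smul (op (p x)) c).symm)

variable {A C}

lemma moritaQ_compat (q : moritaQ A C) (x c : C) : evalQ q.1 c • x = op (q.1 x) • c := q.2 x c

/-- Elements of `Q` are right `*C`-linear. -/
lemma moritaQ_op_smul (q : moritaQ A C) (f : LeftDual A C) (x : C) :
    q.1 (op f • x) = q.1 x * f := by
  ext c
  change _ = f.lin (op (q.1 x) • c)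
  rw [← moritaQ_compat]
  change (q.1 (BT.rsmul f.lin (comulR A C x))).lin c =
    f.lin (BT.lsmul (evalQ q.1 c).lin (comulR A C x))
  induction comulR A C x using BT.induction with
  | h0 => simp
  | ht u v => simp
  | ha u v hu hv => simp only [map_add, LeftDual.add_lin, hu, hv]

/-- `Q` is a left `*C`-module by `(f q)(x) = f * q(x)`. -/
instance : Module (LeftDual A C) (moritaQ A C) where
  smul f q := ⟨{ toFun := fun x => f * q.1 x
                 map_add' := fun x y => by rw [map_add, mul_add]
                 map_smul' := fun a x => by rw [map_smul]; rfl }, by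
    intro x c
    have h := moritaQ_compat q x (op f • c)
    rw [← mul_smul, ← op_mul] at h
    exact h⟩
  one_smul q := Subtype.ext (LinearMap.ext fun x => one_mul _)
  mul_smul f g q := Subtype.ext (LinearMap.ext fun x => mul_assoc _ _ _)
  smul_zero f := Subtype.ext (LinearMap.ext fun x => mul_zero _)
  smul_add f p q := Subtype.ext (LinearMap.ext fun x => mul_add _ _ _)
  add_smul f g q := Subtype.ext (LinearMap.ext fun x => add_mul _ _ _)
  zero_smul q := Subtype.ext (LinearMap.ext fun x => zero_mul _)

/-- `Q` is a right `C*`-module by `(q t)(x) = q(t · x)`. -/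
instance : Module (RightDual A C)ᵐᵒᵖ (moritaQ A C) where
  smul t q := ⟨q.1.comp (lact t.unop), by
    intro x c
    have h := moritaQ_compat q (t.unop • x) c
    rw [← mul_smul] at h
    exact h⟩
  one_smul q := Subtype.ext (LinearMap.ext fun x => congrArg q.1 (one_smul (RightDual A C) x))
  mul_smul s t q := Subtype.ext (LinearMap.ext fun x =>
    congrArg q.1 (mul_smul t.unop s.unop x))
  smul_zero t := rfl
  smul_add t p q := rfl
  add_smul s t q := Subtype.ext (LinearMap.ext fun x =>
    (congrArg q.1 (add_smul s.unop t.unop x)).trans (map_add q.1 _ _))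
  zero_smul q := Subtype.ext (LinearMap.ext fun x =>
    (congrArg q.1 (zero_smul (RightDual A C) x)).trans (map_zero q.1))

instance : SMulCommClass (LeftDual A C) (RightDual A C)ᵐᵒᵖ (moritaQ A C) where
  smul_comm _ _ _ := rfl

variable (A C)

/-- The Morita context `(C*, *C, C, Q, ▽, ▲)` of the coring `C`, where `C*` stands for the
isomorphic ring of comodule endomorphisms of `C`, with `(x ▽ q)(y) = q(y)(x)` (so that
`(x ▽ q) · y = x₁ q(y)(x₂)`) and `q ▲ x = q(x)`. -/
def coringContext : MoritaContext (RightDual A C) (LeftDual A C) C (moritaQ A C) where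
  μ := BT.lift₂ (fun x q => evalQ q.1 x)
    (fun x y q => RightDual.ext fun c => map_add (q.1 c).lin x y)
    (fun x p q => rfl)
    (fun x f q => rfl)
  τ := BT.lift₂ (fun q x => q.1 x) (fun p q x => rfl) (fun q x y => map_add q.1 x y)
    (fun q t x => rfl)
  μ_smul r t := by
    induction t using BT.induction with
    | h0 => simp
    | ht x q =>
      refine RightDual.ext fun c => ?_
      change (q.1 c).lin (r • x) = r.lin (evalQ q.1 x • c)
      rw [moritaQ_compat]
      change (q.1 c).lin (BT.lsmul r.lin (comulR A C x)) =
        r.lin (BT.rsmul (q.1 c).lin (comulR A C x))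
      induction comulR A C x using BT.induction with
      | h0 => simp
      | ht u v => simp
      | ha u v hu hv => simp only [map_add, hu, hv]
    | ha u v hu hv => simp only [smul_add, map_add, hu, hv]
  μ_op_smul r t := by
    induction t using BT.induction with
    | h0 => simp
    | ht x q => rfl
    | ha u v hu hv => simp only [smul_add, map_add, hu, hv]
  τ_smul s t := by
    induction t using BT.induction with
    | h0 => simp
    | ht q x => rfl
    | ha u v hu hv => simp only [smul_add, map_add, hu, hv]
  τ_op_smul s t := by
    induction t using BT.induction with
    | h0 => simp
    | ht q x => exact moritaQ_op_smul q s.unop x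
    | ha u v hu hv => simp only [smul_add, map_add, hu, hv]
  μ_τ p q p' := moritaQ_compat q p' p
  τ_μ q p q' := Subtype.ext (LinearMap.ext fun y => by
    change q.1 p * q'.1 y = q.1 (evalQ q'.1 p • y)
    rw [moritaQ_compat, moritaQ_op_smul])

end CoringContext

/-! ### Comodules -/

section Comodules

variable (A C : Type u) [Ring A] [AddCommGroup C] [Module A C] [Module Aᵐᵒᵖ C]
    [SMulCommClass A Aᵐᵒᵖ C] [Coring A C]

open Coring

/-- A right `C`-comodule: a right `A`-module `M` with a coassociative and counital right
`A`-linear coaction `M → M ⊗_A C`. -/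
structure RComod where
  carrier : Type u
  [addCommGroup : AddCommGroup carrier]
  [module : Module Aᵐᵒᵖ carrier]
  coact : carrier →ₗ[Aᵐᵒᵖ] BT A carrier C
  coassoc : ∀ m, BT.map coact (LinearMap.id (R := A) (M := C)) (coact m) =
    BT.assocInv (BT.map (LinearMap.id (R := Aᵐᵒᵖ)) (comulL A C) (coact m))
  counit : ∀ m, BT.rsmul (counitL A C).lin (coact m) = m

/-- A left `C`-comodule: a left `A`-module `M` with a coassociative and counital left
`A`-linear coaction `M → C ⊗_A M`. -/
structure LComod where
  carrier : Type u
  [addCommGroup : AddCommGroup carrier]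
  [module : Module A carrier]
  coact : carrier →ₗ[A] BT A C carrier
  coassoc : ∀ m, BT.map (LinearMap.id (R := Aᵐᵒᵖ) (M := C)) coact (coact m) =
    BT.assoc (BT.map (comulR A C) (LinearMap.id (R := A)) (coact m))
  counit : ∀ m, BT.lsmul (counitR A C).lin (coact m) = m

variable {A C}

namespace RComod

instance (M : RComod A C) : AddCommGroup M.carrier := M.addCommGroup
instance (M : RComod A C) : Module Aᵐᵒᵖ M.carrier := M.module

/-- Maps of right comodules. -/
@[ext] structure Hom (M N : RComod A C) where
  lin : M.carrier →ₗ[Aᵐᵒᵖ] N.carrier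
  comm : ∀ m, N.coact (lin m) = BT.map lin (LinearMap.id (R := A) (M := C)) (M.coact m)

/-- The category of right `C`-comodules. -/
instance : Category (RComod A C) where
  Hom := Hom
  id M := ⟨LinearMap.id, fun m => by
    change M.coact m = _
    induction M.coact m using BT.induction with
    | h0 => simp
    | ht x y => rfl
    | ha x y hx hy => rw [map_add, ← hx, ← hy]⟩
  comp f g := ⟨g.lin.comp f.lin, fun m => by
    rw [LinearMap.comp_apply, g.comm, f.comm]
    induction RComod.coact _ m using BT.induction with
    | h0 => simp
    | ht x y => rfl
    | ha x y hx hy => simp only [map_add, hx, hy]⟩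

variable (A C) in
/-- The coring as a right comodule over itself. -/
def self : RComod A C where
  carrier := C
  coact := comulR A C
  coassoc := coassoc'
  counit := comul_counit

end RComod

namespace LComod

instance (M : LComod A C) : AddCommGroup M.carrier := M.addCommGroup
instance (M : LComod A C) : Module A M.carrier := M.module

/-- Maps of left comodules. -/
@[ext] structure Hom (M N : LComod A C) where
  lin : M.carrier →ₗ[A] N.carrier
  comm : ∀ m, N.coact (lin m) = BT.map (LinearMap.id (R := Aᵐᵒᵖ) (M := C)) lin (M.coact m)

/-- The category of left `C`-comodules. -/
instance : Category (LComod A C) where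
  Hom := Hom
  id M := ⟨LinearMap.id, fun m => by
    change M.coact m = _
    induction M.coact m using BT.induction with
    | h0 => simp
    | ht x y => rfl
    | ha x y hx hy => rw [map_add, ← hx, ← hy]⟩
  comp f g := ⟨g.lin.comp f.lin, fun m => by
    rw [LinearMap.comp_apply, g.comm, f.comm]
    induction LComod.coact _ m using BT.induction with
    | h0 => simp
    | ht x y => rfl
    | ha x y hx hy => simp only [map_add, hx, hy]⟩

variable (A C) in
/-- The coring as a left comodule over itself. -/
def self : LComod A C where
  carrier := C
  coact := comulL A C
  coassoc c := by
    change _ = BT.assoc (BT.map (comulR A C) LinearMap.id (comulR A C c))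
    rw [coassoc', BT.assoc_assocInv]
    rfl
  counit := counit_comul

end LComod

end Comodules

/-! ### Tensor functors -/

section Functors

lemma BT.map_op_smul {R S M N M' N' : Type u} [Ring R] [Ring S] [AddCommGroup M] [AddCommGroup N]
    [AddCommGroup M'] [AddCommGroup N'] [Module Rᵐᵒᵖ M] [Module Rᵐᵒᵖ M'] [Module R N] [Module R N']
    [Module Sᵐᵒᵖ N] [SMulCommClass R Sᵐᵒᵖ N] [Module Sᵐᵒᵖ N'] [SMulCommClass R Sᵐᵒᵖ N']
    (f : M →ₗ[Rᵐᵒᵖ] M') (g : N →ₗ[R] N') (hg : ∀ (s : Sᵐᵒᵖ) n, g (s • n) = s • g n)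
    (s : Sᵐᵒᵖ) (t : BT R M N) : BT.map f g (s • t) = s • BT.map f g t := by
  induction t using BT.induction with
  | h0 => simp
  | ht m n => rw [BT.smul_right_tmul, BT.map_tmul, hg]; rfl
  | ha x y hx hy => simp only [smul_add, map_add, hx, hy]

lemma BT.map_smul {R S M N M' N' : Type u} [Ring R] [Ring S] [AddCommGroup M] [AddCommGroup N]
    [AddCommGroup M'] [AddCommGroup N'] [Module Rᵐᵒᵖ M] [Module Rᵐᵒᵖ M'] [Module R N] [Module R N']
    [Module S M] [SMulCommClass S Rᵐᵒᵖ M] [Module S M'] [SMulCommClass S Rᵐᵒᵖ M']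
    (f : M →ₗ[Rᵐᵒᵖ] M') (g : N →ₗ[R] N') (hf : ∀ (s : S) m, f (s • m) = s • f m)
    (s : S) (t : BT R M N) : BT.map f g (s • t) = s • BT.map f g t := by
  induction t using BT.induction with
  | h0 => simp
  | ht m n => rw [BT.smul_left_tmul, BT.map_tmul, hf]; rfl
  | ha x y hx hy => simp only [smul_add, map_add, hx, hy]

lemma BT.assocInv_op_smul {R S T M N P : Type u} [Ring R] [Ring S] [Ring T] [AddCommGroup M]
    [AddCommGroup N] [AddCommGroup P] [Module Rᵐᵒᵖ M] [Module R N] [Module Sᵐᵒᵖ N]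
    [SMulCommClass R Sᵐᵒᵖ N] [Module S P] [Module Tᵐᵒᵖ P] [SMulCommClass S Tᵐᵒᵖ P]
    [SMulCommClass R Tᵐᵒᵖ (BT S N P)]
    (a : Tᵐᵒᵖ) (t : BT R M (BT S N P)) : BT.assocInv (a • t) = a • BT.assocInv t := by
  induction t using BT.induction with
  | h0 => simp
  | ht m t =>
    rw [BT.smul_right_tmul]
    induction t using BT.induction with
    | h0 => simp [BT.tmul_zero]
    | ht n p => rfl
    | ha x y hx hy => rw [smul_add, BT.tmul_add, BT.tmul_add, map_add, map_add, hx, hy, smul_add]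
  | ha x y hx hy => rw [smul_add, map_add, map_add, hx, hy, smul_add]

lemma BT.assoc_smul {R S T M N P : Type u} [Ring R] [Ring S] [Ring T] [AddCommGroup M]
    [AddCommGroup N] [AddCommGroup P] [Module Rᵐᵒᵖ M] [Module R N] [Module Sᵐᵒᵖ N]
    [SMulCommClass R Sᵐᵒᵖ N] [Module S P] [Module T M] [SMulCommClass T Rᵐᵒᵖ M]
    [SMulCommClass T Sᵐᵒᵖ (BT R M N)]
    (a : T) (t : BT S (BT R M N) P) : BT.assoc (a • t) = a • BT.assoc t := by
  induction t using BT.induction with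
  | h0 => simp
  | ht t p =>
    rw [BT.smul_left_tmul]
    induction t using BT.induction with
    | h0 => simp [BT.zero_tmul]
    | ht n p => rfl
    | ha x y hx hy => rw [smul_add, BT.add_tmul, BT.add_tmul, map_add, map_add, hx, hy, smul_add]
  | ha x y hx hy => rw [smul_add, map_add, map_add, hx, hy, smul_add]

instance BT.smulComm {R S T M N : Type u} [Ring R] [Ring S] [Ring T] [AddCommGroup M]
    [AddCommGroup N] [Module Rᵐᵒᵖ M] [Module R N] [Module S M] [SMulCommClass S Rᵐᵒᵖ M]
    [Module Tᵐᵒᵖ N] [SMulCommClass R Tᵐᵒᵖ N] : SMulCommClass S Tᵐᵒᵖ (BT R M N) where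
  smul_comm s t x := by
    induction x using BT.induction with
    | h0 => simp
    | ht m n => rfl
    | ha x y hx hy => simp only [smul_add, hx, hy]

/-- The functor `- ⊗_R P` from right `R`-modules to right `S`-modules, for an `R`-`S` bimodule
`P`. -/
def bimoduleTensor (R S P : Type u) [Ring R] [Ring S] [AddCommGroup P] [Module R P]
    [Module Sᵐᵒᵖ P] [SMulCommClass R Sᵐᵒᵖ P] : ModuleCat.{u} Rᵐᵒᵖ ⥤ ModuleCat.{u} Sᵐᵒᵖ where
  obj N := ModuleCat.of Sᵐᵒᵖ (BT R N P)
  map f := ModuleCat.ofHom { BT.map f.hom (LinearMap.id (R := R) (M := P)) with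
    map_smul' := BT.map_op_smul _ _ (fun _ _ => rfl) }
  map_id N := by
    ext t
    change BT.map _ _ t = t
    induction t using BT.induction with
    | h0 => simp
    | ht m n => rfl
    | ha x y hx hy => rw [map_add, hx, hy]
  map_comp f g := by
    ext t
    change BT.map _ _ t = BT.map _ _ (BT.map _ _ t)
    induction t using BT.induction with
    | h0 => simp
    | ht m n => rfl
    | ha x y hx hy => rw [map_add, map_add, map_add, hx, hy]

variable (A C : Type u) [Ring A] [AddCommGroup C] [Module A C] [Module Aᵐᵒᵖ C]
    [SMulCommClass A Aᵐᵒᵖ C] [Coring A C]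

open Coring

/-- The comultiplication is left `C*`-linear. -/
def comulRD : C →ₗ[RightDual A C] BT A C C :=
  { comul (A := A) with map_smul' := fun f c => comul_lact f c }

/-- The comultiplication is right `*C`-linear. -/
def comulLD : C →ₗ[(LeftDual A C)ᵐᵒᵖ] BT A C C :=
  { comul (A := A) with map_smul' := fun f c => comul_ract f.unop c }

variable {A C} in
/-- The right `A`-linear map `c ↦ n ⊗ c` to `N ⊗_{C*} C`. -/
def inclR {N : Type u} [AddCommGroup N] [Module (RightDual A C)ᵐᵒᵖ N] (n : N) :
    C →ₗ[Aᵐᵒᵖ] BT (RightDual A C) N C where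
  toFun c := BT.tmul _ n c
  map_add' := BT.tmul_add n
  map_smul' _ _ := rfl

variable {A C} in
/-- The left `A`-linear map `c ↦ c ⊗ n` to `C ⊗_{*C} N`. -/
def inclL {N : Type u} [AddCommGroup N] [Module (LeftDual A C) N] (n : N) :
    C →ₗ[A] BT (LeftDual A C) C N where
  toFun c := BT.tmul _ c n
  map_add' c c' := BT.add_tmul c c' n
  map_smul' _ _ := rfl

/-- The coaction `n ⊗ c ↦ (n ⊗ c₁) ⊗ c₂` of `N ⊗_{C*} C`. -/
def coactR (N : Type u) [AddCommGroup N] [Module (RightDual A C)ᵐᵒᵖ N] :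
    BT (RightDual A C) N C →ₗ[Aᵐᵒᵖ] BT A (BT (RightDual A C) N C) C :=
  { BT.assocInv.comp (BT.map (LinearMap.id (M := N)) (comulRD A C)) with
    map_smul' := fun a t =>
      (congrArg BT.assocInv (BT.map_op_smul _ (comulRD A C) comul_op_smul a t)).trans
        (BT.assocInv_op_smul a _) }

/-- The coaction `c ⊗ n ↦ c₁ ⊗ (c₂ ⊗ n)` of `C ⊗_{*C} N`. -/
def coactL (N : Type u) [AddCommGroup N] [Module (LeftDual A C) N] :
    BT (LeftDual A C) C N →ₗ[A] BT A C (BT (LeftDual A C) C N) :=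
  { BT.assoc.comp (BT.map (comulLD A C) (LinearMap.id (M := N))) with
    map_smul' := fun a t =>
      (congrArg BT.assoc (BT.map_smul (comulLD A C) _ comul_smul a t)).trans
        (BT.assoc_smul a _) }

lemma coactR_tmul {N : Type u} [AddCommGroup N] [Module (RightDual A C)ᵐᵒᵖ N] (n : N) (c : C) :
    coactR A C N (BT.tmul _ n c) = BT.map (inclR n) LinearMap.id (comulR A C c) := by
  change BT.assocInv (BT.tmul _ n (comulR A C c)) = _
  induction comulR A C c using BT.induction with
  | h0 => simp [BT.tmul_zero]
  | ht x y => rfl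
  | ha x y hx hy => rw [BT.tmul_add, map_add, map_add, hx, hy]

lemma coactL_tmul {N : Type u} [AddCommGroup N] [Module (LeftDual A C) N] (n : N) (c : C) :
    coactL A C N (BT.tmul _ c n) = BT.map LinearMap.id (inclL n) (comulL A C c) := by
  change BT.assoc (BT.tmul _ (comulL A C c) n) = _
  induction comulL A C c using BT.induction with
  | h0 => simp [BT.zero_tmul]
  | ht x y => rfl
  | ha x y hx hy => rw [BT.add_tmul, map_add, map_add, hx, hy]

lemma coactR_coassoc (N : Type u) [AddCommGroup N] [Module (RightDual A C)ᵐᵒᵖ N]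
    (t : BT (RightDual A C) N C) :
    BT.map (coactR A C N) (LinearMap.id (R := A) (M := C)) (coactR A C N t) =
      BT.assocInv (BT.map (LinearMap.id (R := Aᵐᵒᵖ)) (comulL A C) (coactR A C N t)) := by
  induction t using BT.induction with
  | h0 => simp
  | ha x y hx hy => rw [map_add, map_add, map_add, map_add, hx, hy]
  | ht n c =>
    let J : BT A C C →ₗ[Aᵐᵒᵖ] BT A (BT (RightDual A C) N C) C :=
      { BT.map (inclR n) (LinearMap.id (R := A) (M := C)) with
        map_smul' := BT.map_op_smul _ _ (fun _ _ => rfl) }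
    have h1 : ∀ s : BT A C C, BT.map (coactR A C N) (LinearMap.id (R := A) (M := C))
        (BT.map (inclR n) LinearMap.id s) =
        BT.map J LinearMap.id (BT.map (comulR A C) LinearMap.id s) := by
      intro s
      induction s using BT.induction with
      | h0 => simp
      | ht x y => exact congrArg (fun z => BT.tmul A z y) (coactR_tmul A C n x)
      | ha x y hx hy => simp only [map_add, hx, hy]
    have h2 : ∀ s : BT A C C, BT.assocInv (BT.map LinearMap.id (comulL A C)
        (BT.map (inclR n) LinearMap.id s)) =
        BT.map J LinearMap.id (BT.assocInv (BT.map LinearMap.id (comulL A C) s)) := by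
      intro s
      induction s using BT.induction with
      | h0 => simp
      | ht x y =>
        change BT.assocInv (BT.tmul A (inclR n x) (comulL A C y)) =
          BT.map J LinearMap.id (BT.assocInv (BT.tmul A x (comulL A C y)))
        induction comulL A C y using BT.induction with
        | h0 => simp [BT.tmul_zero]
        | ht u v => rfl
        | ha u v hu hv => rw [BT.tmul_add, BT.tmul_add, map_add, map_add, map_add, hu, hv]
      | ha x y hx hy => simp only [map_add, hx, hy]
    rw [coactR_tmul, h1, h2, coassoc']

lemma coactL_coassoc (N : Type u) [AddCommGroup N] [Module (LeftDual A C) N]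
    (t : BT (LeftDual A C) C N) :
    BT.map (LinearMap.id (R := Aᵐᵒᵖ) (M := C)) (coactL A C N) (coactL A C N t) =
      BT.assoc (BT.map (comulR A C) (LinearMap.id (R := A)) (coactL A C N t)) := by
  induction t using BT.induction with
  | h0 => simp
  | ha x y hx hy => rw [map_add, map_add, map_add, map_add, hx, hy]
  | ht c n =>
    let J : BT A C C →ₗ[A] BT A C (BT (LeftDual A C) C N) :=
      { BT.map (LinearMap.id (R := Aᵐᵒᵖ) (M := C)) (inclL n) with
        map_smul' := BT.map_smul _ _ (fun _ _ => rfl) }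
    have h1 : ∀ s : BT A C C, BT.map (LinearMap.id (R := Aᵐᵒᵖ) (M := C)) (coactL A C N)
        (BT.map LinearMap.id (inclL n) s) =
        BT.map LinearMap.id J (BT.map LinearMap.id (comulL A C) s) := by
      intro s
      induction s using BT.induction with
      | h0 => simp
      | ht x y => exact congrArg (fun z => BT.tmul A x z) (coactL_tmul A C n y)
      | ha x y hx hy => simp only [map_add, hx, hy]
    have h2 : ∀ s : BT A C C, BT.assoc (BT.map (comulR A C) LinearMap.id
        (BT.map LinearMap.id (inclL n) s)) =
        BT.map LinearMap.id J (BT.assoc (BT.map (comulR A C) LinearMap.id s)) := by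
      intro s
      induction s using BT.induction with
      | h0 => simp
      | ht x y =>
        change BT.assoc (BT.tmul A (comulR A C x) (inclL n y)) =
          BT.map LinearMap.id J (BT.assoc (BT.tmul A (comulR A C x) y))
        induction comulR A C x using BT.induction with
        | h0 => simp [BT.zero_tmul]
        | ht u v => rfl
        | ha u v hu hv => rw [BT.add_tmul, BT.add_tmul, map_add, map_add, map_add, hu, hv]
      | ha x y hx hy => simp only [map_add, hx, hy]
    rw [coactL_tmul, h1, h2]
    exact congrArg (BT.map LinearMap.id J) ((LComod.self A C).coassoc c)

lemma coactR_counit (N : Type u) [AddCommGroup N] [Module (RightDual A C)ᵐᵒᵖ N]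
    (t : BT (RightDual A C) N C) : BT.rsmul (counitL A C).lin (coactR A C N t) = t := by
  induction t using BT.induction with
  | h0 => simp
  | ha x y hx hy => rw [map_add, map_add, hx, hy]
  | ht n c =>
    rw [coactR_tmul]
    have h : ∀ s : BT A C C, BT.rsmul (counitL A C).lin (BT.map (inclR n) LinearMap.id s) =
        BT.tmul (RightDual A C) n (BT.rsmul (counitL A C).lin s) := by
      intro s
      induction s using BT.induction with
      | h0 => simp [BT.tmul_zero]
      | ht x y => rfl
      | ha x y hx hy => rw [map_add, map_add, map_add, BT.tmul_add, hx, hy]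
    exact (h _).trans (congrArg (BT.tmul _ n) (ract_counit c))

lemma coactL_counit (N : Type u) [AddCommGroup N] [Module (LeftDual A C) N]
    (t : BT (LeftDual A C) C N) : BT.lsmul (counitR A C).lin (coactL A C N t) = t := by
  induction t using BT.induction with
  | h0 => simp
  | ha x y hx hy => rw [map_add, map_add, hx, hy]
  | ht c n =>
    rw [coactL_tmul]
    have h : ∀ s : BT A C C, BT.lsmul (counitR A C).lin (BT.map LinearMap.id (inclL n) s) =
        BT.tmul (LeftDual A C) (BT.lsmul (counitR A C).lin s) n := by
      intro s
      induction s using BT.induction with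
      | h0 => simp [BT.zero_tmul]
      | ht x y => rfl
      | ha x y hx hy => rw [map_add, map_add, map_add, BT.add_tmul, hx, hy]
    exact (h _).trans (congrArg (fun z => BT.tmul _ z n) (lact_counit c))

variable {A C} in
/-- The right `A`-linear map `f ⊗ C`. -/
def tensorMapR {N N' : Type u} [AddCommGroup N] [Module (RightDual A C)ᵐᵒᵖ N] [AddCommGroup N']
    [Module (RightDual A C)ᵐᵒᵖ N'] (f : N →ₗ[(RightDual A C)ᵐᵒᵖ] N') :
    BT (RightDual A C) N C →ₗ[Aᵐᵒᵖ] BT (RightDual A C) N' C :=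
  { BT.map f (LinearMap.id (R := RightDual A C) (M := C)) with
    map_smul' := BT.map_op_smul _ _ (fun _ _ => rfl) }

variable {A C} in
/-- The left `A`-linear map `C ⊗ f`. -/
def tensorMapL {N N' : Type u} [AddCommGroup N] [Module (LeftDual A C) N] [AddCommGroup N']
    [Module (LeftDual A C) N'] (f : N →ₗ[LeftDual A C] N') :
    BT (LeftDual A C) C N →ₗ[A] BT (LeftDual A C) C N' :=
  { BT.map (LinearMap.id (R := (LeftDual A C)ᵐᵒᵖ) (M := C)) f with
    map_smul' := BT.map_smul _ _ (fun _ _ => rfl) }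

lemma coactR_map {N N' : Type u} [AddCommGroup N] [Module (RightDual A C)ᵐᵒᵖ N] [AddCommGroup N']
    [Module (RightDual A C)ᵐᵒᵖ N'] (f : N →ₗ[(RightDual A C)ᵐᵒᵖ] N')
    (t : BT (RightDual A C) N C) : coactR A C N' (tensorMapR f t) =
      BT.map (tensorMapR f) (LinearMap.id (R := A) (M := C)) (coactR A C N t) := by
  induction t using BT.induction with
  | h0 => simp
  | ha x y hx hy => rw [map_add, map_add, map_add, map_add, hx, hy]
  | ht n c =>
    change coactR A C N' (BT.tmul _ (f n) c) = _
    rw [coactR_tmul, coactR_tmul]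
    induction comulR A C c using BT.induction with
    | h0 => simp
    | ht x y => rfl
    | ha x y hx hy => rw [map_add, map_add, map_add, hx, hy]

lemma coactL_map {N N' : Type u} [AddCommGroup N] [Module (LeftDual A C) N] [AddCommGroup N']
    [Module (LeftDual A C) N'] (f : N →ₗ[LeftDual A C] N')
    (t : BT (LeftDual A C) C N) : coactL A C N' (tensorMapL f t) =
      BT.map (LinearMap.id (R := Aᵐᵒᵖ) (M := C)) (tensorMapL f) (coactL A C N t) := by
  induction t using BT.induction with
  | h0 => simp
  | ha x y hx hy => rw [map_add, map_add, map_add, map_add, hx, hy]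
  | ht c n =>
    change coactL A C N' (BT.tmul _ c (f n)) = _
    rw [coactL_tmul, coactL_tmul]
    induction comulL A C c using BT.induction with
    | h0 => simp
    | ht x y => rfl
    | ha x y hx hy => rw [map_add, map_add, map_add, hx, hy]

/-- The functor `- ⊗_{C*} C` from right `C*`-modules to right `C`-comodules; the coaction is
`n ⊗ c ↦ (n ⊗ c₁) ⊗ c₂`. -/
def rightTensor : ModuleCat.{u} (RightDual A C)ᵐᵒᵖ ⥤ RComod A C where
  obj N :=
    { carrier := BT (RightDual A C) N C
      coact := coactR A C N
      coassoc := coactR_coassoc A C N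
      counit := coactR_counit A C N }
  map f :=
    { lin := tensorMapR f.hom
      comm := coactR_map A C f.hom }
  map_id N := by
    refine RComod.Hom.ext (LinearMap.ext fun t => ?_)
    change BT.map _ _ t = t
    induction t using BT.induction with
    | h0 => simp
    | ht m n => rfl
    | ha x y hx hy => rw [map_add, hx, hy]
  map_comp f g := by
    refine RComod.Hom.ext (LinearMap.ext fun t => ?_)
    change BT.map _ _ t = BT.map _ _ (BT.map _ _ t)
    induction t using BT.induction with
    | h0 => simp
    | ht m n => rfl
    | ha x y hx hy => rw [map_add, map_add, map_add, hx, hy]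

/-- The functor `C ⊗_{*C} -` from left `*C`-modules to left `C`-comodules; the coaction is
`c ⊗ n ↦ c₁ ⊗ (c₂ ⊗ n)`. -/
def leftTensor : ModuleCat.{u} (LeftDual A C) ⥤ LComod A C where
  obj N :=
    { carrier := BT (LeftDual A C) C N
      coact := coactL A C N
      coassoc := coactL_coassoc A C N
      counit := coactL_counit A C N }
  map f :=
    { lin := tensorMapL f.hom
      comm := coactL_map A C f.hom }
  map_id N := by
    refine LComod.Hom.ext (LinearMap.ext fun t => ?_)
    change BT.map _ _ t = t
    induction t using BT.induction with
    | h0 => simp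
    | ht m n => rfl
    | ha x y hx hy => rw [map_add, hx, hy]
  map_comp f g := by
    refine LComod.Hom.ext (LinearMap.ext fun t => ?_)
    change BT.map _ _ t = BT.map _ _ (BT.map _ _ t)
    induction t using BT.induction with
    | h0 => simp
    | ht m n => rfl
    | ha x y hx hy => rw [map_add, map_add, map_add, hx, hy]

end Functors

/-! ### Module and object properties -/

section Properties

/-- `M` is (isomorphic to) a direct summand of `Nⁿ` for some natural number `n`. -/
def IsSummandOfPower (R M N : Type u) [Ring R] [AddCommGroup M] [AddCommGroup N] [Module R M]
    [Module R N] : Prop :=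
  ∃ (n : ℕ) (i : M →ₗ[R] (Fin n → N)) (p : (Fin n → N) →ₗ[R] M), p ∘ₗ i = LinearMap.id

/-- Similar modules: each is a direct summand of a finite power of the other. -/
def Similar (R M N : Type u) [Ring R] [AddCommGroup M] [AddCommGroup N] [Module R M]
    [Module R N] : Prop :=
  IsSummandOfPower R M N ∧ IsSummandOfPower R N M

/-- Finitely generated projective modules. -/
def FGProjective (R M : Type u) [Ring R] [AddCommGroup M] [Module R M] : Prop :=
  Module.Finite R M ∧ Module.Projective R M

/-- Weakly locally projective modules: every map `f : M → Y` can be lifted along every surjection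
`g : X → Y` when restricted to a finitely generated submodule of `M`, by a map defined on `M`. -/
def WeaklyLocallyProjective (R M : Type u) [Ring R] [AddCommGroup M] [Module R M] : Prop :=
  ∀ (E : Submodule R M), E.FG → ∀ (X Y : Type u) [AddCommGroup X] [AddCommGroup Y] [Module R X]
    [Module R Y] (f : M →ₗ[R] Y) (g : X →ₗ[R] Y), Function.Surjective g →
    ∃ h : M →ₗ[R] X, ∀ e ∈ E, g (h e) = f e

/-- A left `R`-module `F` is faithfully flat if `- ⊗_R F` preserves and reflects exactness of
sequences of right `R`-modules. -/
def FaithfullyFlatLeft (R F : Type u) [Ring R] [AddCommGroup F] [Module R F] : Prop :=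
  ∀ (X Y Z : Type u) [AddCommGroup X] [AddCommGroup Y] [AddCommGroup Z] [Module Rᵐᵒᵖ X]
    [Module Rᵐᵒᵖ Y] [Module Rᵐᵒᵖ Z] (f : X →ₗ[Rᵐᵒᵖ] Y) (g : Y →ₗ[Rᵐᵒᵖ] Z),
    Function.Exact f g ↔ Function.Exact (BT.map f (LinearMap.id (R := R) (M := F)))
      (BT.map g (LinearMap.id (R := R) (M := F)))

/-- A right `R`-module `F` is faithfully flat if `F ⊗_R -` preserves and reflects exactness of
sequences of left `R`-modules. -/
def FaithfullyFlatRight (R F : Type u) [Ring R] [AddCommGroup F] [Module Rᵐᵒᵖ F] : Prop :=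
  ∀ (X Y Z : Type u) [AddCommGroup X] [AddCommGroup Y] [AddCommGroup Z] [Module R X]
    [Module R Y] [Module R Z] (f : X →ₗ[R] Y) (g : Y →ₗ[R] Z),
    Function.Exact f g ↔ Function.Exact (BT.map (LinearMap.id (R := Rᵐᵒᵖ) (M := F)) f)
      (BT.map (LinearMap.id (R := Rᵐᵒᵖ) (M := F)) g)

/-- An object `X` is finitely generated if, whenever `X` is the join of a nonempty directed family
of subobjects, it is equal to one of them. -/
def FinitelyGeneratedObject {𝒞 : Type (u + 1)} [Category.{u} 𝒞] (X : 𝒞) : Prop :=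
  ∀ s : Set (Subobject X), s.Nonempty → DirectedOn (· ≤ ·) s → IsLUB s ⊤ → ⊤ ∈ s

/-- A finitely generated projective generator of a category. -/
def IsProgenerator {𝒞 : Type (u + 1)} [Category.{u} 𝒞] (X : 𝒞) : Prop :=
  FinitelyGeneratedObject X ∧ Projective X ∧ IsSeparator X

end Properties

end CoringTheory
end

noncomputable section

namespace CoringTheory

/-! ### Summands of finite powers, dual bases and similarity -/

section ModuleProperties

variable {R M N : Type u} [Ring R] [AddCommGroup M] [AddCommGroup N] [Module R M] [Module R N]

/-! The mediator is the group Q. Every q in Q is a right *C-linear map C → *C and, evaluated in the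
other variable, a left C*-linear map C → C*. When *C, respectively C*, separates the points of C,
every such linear map comes from Q (`moritaQ.ofRight`, `moritaQ.ofLeft`). Elements of C, in turn,
are the same as linear maps *C → C, or C* → C.

A single equation Σ x_k ▽ q_k = ε therefore has two readings. Applied to c it says c = Σ x_k ·
q_k(c), so C is a summand of a power of *C; read in C* it says that the maps C → C* given by the q_k
send the x_k to elements with sum 1, so C* is a summand of a power of C. The equation Σ r_k ▲ y_k =
ε has the mirror readings: C is a summand of a power of C*, and *C is a summand of a power of C.
Conditions (0), (1) and (2) each select one reading of each equation, so each amounts to strictness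
(`similar_of_strict` and the lemmas `μ_surjective_of_right`, `μ_surjective_of_left`,
`τ_surjective_of_left`, `τ_surjective_of_right`). Expanding Δ(x_k) and Δ(y_k) in c = Σ x_k · q_k(c)
and its mirror gives dual bases of C over A on both sides.

If C is finitely generated projective as a left A-module, contracting coactions with functionals
identifies right C-comodules with right *C-modules (`isEquivalence_rComodToModule`). This takes C to
C and turns - ⊗_{C*} C into the tensor functor of the bimodule C. Progenerator conditions become
similarity, and Morita's theorem makes the tensor functors equivalences when the context is strict.
An equivalence preserves and reflects exactness, which is faithful flatness of C.

Conversely, finiteness over A makes C finitely presented over C*, so flatness makes it projective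
and ▲ is surjective; then (C*/im ▽) ⊗ C = 0, and faithfulness gives surjectivity of ▽. Over *C the
roles of the two maps are exchanged. -/

lemma isSummandOfPower_iff : IsSummandOfPower R M N ↔
    ∃ (n : ℕ) (f : Fin n → M →ₗ[R] N) (g : Fin n → N →ₗ[R] M), ∀ m, ∑ k, g k (f k m) = m := by
  constructor
  · rintro ⟨n, i, p, h⟩
    refine ⟨n, fun k => LinearMap.proj k ∘ₗ i,
      fun k => p ∘ₗ LinearMap.single R (fun _ => N) k, fun m => ?_⟩
    simp only [LinearMap.comp_apply, LinearMap.proj_apply, ← map_sum, LinearMap.single_apply]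
    rw [Finset.univ_sum_single]
    exact LinearMap.congr_fun h m
  · rintro ⟨n, f, g, h⟩
    refine ⟨n, LinearMap.pi f, ∑ k, g k ∘ₗ LinearMap.proj k, LinearMap.ext fun m => ?_⟩
    simpa using h m

lemma IsSummandOfPower.of_equiv {N' : Type u} [AddCommGroup N'] [Module R N'] (e : N ≃ₗ[R] N')
    (h : IsSummandOfPower R M N) : IsSummandOfPower R M N' := by
  rw [isSummandOfPower_iff] at h ⊢
  obtain ⟨n, f, g, h⟩ := h
  exact ⟨n, fun k => e.toLinearMap ∘ₗ f k, fun k => g k ∘ₗ e.symm.toLinearMap,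
    fun m => by simpa using h m⟩

lemma IsSummandOfPower.equiv_of {N' : Type u} [AddCommGroup N'] [Module R N'] (e : N ≃ₗ[R] N')
    (h : IsSummandOfPower R N M) : IsSummandOfPower R N' M := by
  rw [isSummandOfPower_iff] at h ⊢
  obtain ⟨n, f, g, h⟩ := h
  exact ⟨n, fun k => f k ∘ₗ e.symm.toLinearMap, fun k => e.toLinearMap ∘ₗ g k,
    fun m => by simp [← map_sum, h]⟩

lemma Similar.of_equiv {N' : Type u} [AddCommGroup N'] [Module R N'] (e : N ≃ₗ[R] N')
    (h : Similar R M N) : Similar R M N' :=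
  ⟨h.1.of_equiv e, h.2.equiv_of e⟩

lemma fgProjective_iff_isSummandOfPower : FGProjective R M ↔ IsSummandOfPower R M R := by
  constructor
  · rintro ⟨_, _⟩
    obtain ⟨n, f, g, -, -, h⟩ := Module.Finite.exists_comp_eq_id_of_projective R M
    exact ⟨n, g, f, h⟩
  · rintro ⟨n, i, p, h⟩
    exact ⟨Module.Finite.of_surjective p fun m => ⟨i m, LinearMap.congr_fun h m⟩,
      Module.Projective.of_split i p h⟩

/-- The dual basis lemma. -/
lemma FGProjective.exists_dual_basis (h : FGProjective R M) :
    ∃ (n : ℕ) (f : Fin n → M →ₗ[R] R) (x : Fin n → M), ∀ m, ∑ k, f k m • x k = m := by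
  obtain ⟨n, f, g, h⟩ := isSummandOfPower_iff.1 (fgProjective_iff_isSummandOfPower.1 h)
  refine ⟨n, f, fun k => g k 1, fun m => ?_⟩
  conv_rhs => rw [← h m]
  simp [← map_smul]

lemma FGProjective.of_dual_basis {ι : Type*} [Fintype ι] (f : ι → M →ₗ[R] R) (x : ι → M)
    (h : ∀ m, ∑ k, f k m • x k = m) : FGProjective R M := by
  let p : (ι → R) →ₗ[R] M := ∑ k, (LinearMap.toSpanSingleton R M (x k)) ∘ₗ LinearMap.proj k
  have hp : p ∘ₗ LinearMap.pi f = LinearMap.id := LinearMap.ext fun m => by simpa [p] using h m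
  exact ⟨Module.Finite.of_surjective p fun m => ⟨_, LinearMap.congr_fun hp m⟩,
    Module.Projective.of_split _ p hp⟩

lemma FGProjective.weaklyLocallyProjective (h : FGProjective R M) :
    WeaklyLocallyProjective R M := by
  intro E _ X Y _ _ _ _ f g hg
  have := h.2
  obtain ⟨l, hl⟩ := Module.projective_lifting_property g f hg
  exact ⟨l, fun e _ => LinearMap.congr_fun hl e⟩

/-- Linear functionals separate the points of a weakly locally projective module. -/
lemma WeaklyLocallyProjective.eq_zero (h : WeaklyLocallyProjective R M) (m : M)
    (hm : ∀ f : M →ₗ[R] R, f m = 0) : m = 0 := by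
  -- The identity is lifted, on the cyclic submodule of m, to the free module on all elements of M.
  -- The coordinates of the lift are functionals, so they vanish at m.
  obtain ⟨l, hl⟩ := h (Submodule.span R {m}) (Submodule.fg_span_singleton m) (M →₀ R) M
    LinearMap.id (Finsupp.linearCombination R _root_.id) (Finsupp.linearCombination_id_surjective R M)
  have h0 : l m = 0 := Finsupp.ext fun x => hm (Finsupp.lapply x ∘ₗ l)
  have := hl m (Submodule.mem_span_singleton_self m)
  rw [h0, map_zero] at this
  exact this.symm

/-- A projective module whose maps to `R` generate `R`. -/
lemma similar_of_sum_eq_one (h : FGProjective R M) {n : ℕ} (f : Fin n → M →ₗ[R] R)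
    (x : Fin n → M) (hx : ∑ k, f k (x k) = 1) : Similar R M R := by
  refine ⟨fgProjective_iff_isSummandOfPower.1 h, isSummandOfPower_iff.2
    ⟨n, fun k => LinearMap.toSpanSingleton R M (x k), f, fun r => ?_⟩⟩
  simp [← Finset.mul_sum, hx]

lemma Similar.exists_sum_eq_one (h : Similar R M R) : ∃ (n : ℕ) (f : Fin n → M →ₗ[R] R)
    (x : Fin n → M), ∑ k, f k (x k) = 1 := by
  obtain ⟨n, f, g, h⟩ := isSummandOfPower_iff.1 h.2
  exact ⟨n, g, fun k => f k 1, h 1⟩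

end ModuleProperties

/-! ### Progenerators in module categories and under equivalences -/

section Progenerators

/-- Finite generation depends only on the ordered set of subobjects, so it passes along equivalences
and isomorphisms. -/
lemma FinitelyGeneratedObject.of_orderIso {𝒞 𝒟 : Type (u + 1)} [Category.{u} 𝒞] [Category.{u} 𝒟]
    {X : 𝒞} {Y : 𝒟} (e : Subobject X ≃o Subobject Y) (h : FinitelyGeneratedObject X) :
    FinitelyGeneratedObject Y := by
  intro s hs hd hl
  have := h (e.symm '' s) (hs.image _) (hd.mono_comp fun _ _ h => e.symm.monotone h)
    (by rw [OrderIso.isLUB_image]; simpa using hl)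
  obtain ⟨y, hy, h⟩ := this
  rwa [show y = ⊤ by simpa using h] at hy

lemma IsProgenerator.map {𝒞 𝒟 : Type (u + 1)} [Category.{u} 𝒞] [Category.{u} 𝒟]
    (e : 𝒞 ≌ 𝒟) {X : 𝒞} (h : IsProgenerator X) : IsProgenerator (e.functor.obj X) :=
  ⟨h.1.of_orderIso (Subobject.lowerEquivalence (MonoOver.congr X e)).toOrderIso,
    (e.map_projective_iff X).2 h.2.1, h.2.2.of_equivalence e⟩

lemma isProgenerator_of_iso {𝒞 : Type (u + 1)} [Category.{u} 𝒞] {X Y : 𝒞} (i : X ≅ Y)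
    (h : IsProgenerator X) : IsProgenerator Y :=
  ⟨h.1.of_orderIso (Subobject.mapIsoToOrderIso i), Projective.of_iso i h.2.1,
    (isSeparator_def Y).2 fun A B f g hfg => h.2.2.def f g fun k => by
      have := hfg (i.inv ≫ k)
      rwa [Category.assoc, Category.assoc, cancel_epi] at this⟩

variable (R M : Type u) [Ring R] [AddCommGroup M] [Module R M]

/-- Subobjects of a module are its submodules. A module is the directed join of its finitely
generated submodules, and a finitely generated submodule is a compact element of the lattice. -/
lemma finitelyGeneratedObject_iff : FinitelyGeneratedObject (ModuleCat.of R M) ↔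
    Module.Finite R M := by
  let e := ModuleCat.subobjectModule (ModuleCat.of R M)
  rw [Module.finite_def]
  constructor
  · intro h
    have := h (e.symm '' {N | N.FG}) ⟨_, ⊥, Submodule.fg_bot, rfl⟩
      (DirectedOn.mono_comp (fun _ _ h => e.symm.monotone h)
        (fun a ha b hb => ⟨a ⊔ b, Submodule.FG.sup ha hb, le_sup_left, le_sup_right⟩)) (by
        rw [OrderIso.isLUB_image]
        refine ⟨fun _ _ => by simp, fun N hN => ?_⟩
        intro m _
        exact hN (Submodule.fg_span_singleton m) (Submodule.mem_span_singleton_self m))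
    obtain ⟨N, hN, h⟩ := this
    rwa [show N = ⊤ by simpa using h] at hN
  · intro h s hs hd hl
    have h1 := (CompleteLattice.isCompactElement_iff_le_of_directed_sSup_le _ _).1
      ((Submodule.fg_iff_compact _).1 h) (e '' s) (hs.image _)
      (hd.mono_comp fun _ _ h => e.monotone h) (by
        have : IsLUB (e '' s) ⊤ := by
          rw [OrderIso.isLUB_image]; simpa using hl
        rw [this.sSup_eq])
    obtain ⟨_, ⟨X, hX, rfl⟩, h⟩ := h1
    rwa [show X = ⊤ by simpa using h] at hX

/-- Finitely generated projective means being a summand of a power of R; being a separator means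
that the trace ideal is all of R, so that R is a summand of a power of M. -/
lemma isProgenerator_iff_similar : IsProgenerator (ModuleCat.of R M) ↔ Similar R M R := by
  constructor
  · rintro ⟨h1, h2, h3⟩
    have hp : FGProjective R M := ⟨(finitelyGeneratedObject_iff R M).1 h1,
      (IsProjective.iff_projective M).2 h2⟩
    -- T is the trace ideal. The quotient map R → R/T vanishes after every map M → R, so a separator
    -- cannot distinguish it from 0.
    let T : Submodule R R := ⨆ f : M →ₗ[R] R, LinearMap.range f
    have hT : T = ⊤ := by
      have := h3.def (ModuleCat.ofHom T.mkQ) 0 fun k => by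
        ext m
        change T.mkQ (k.hom m) = 0
        rw [Submodule.mkQ_apply, Submodule.Quotient.mk_eq_zero]
        exact Submodule.mem_iSup_of_mem k.hom ⟨m, rfl⟩
      rw [← Submodule.ker_mkQ T, LinearMap.ker_eq_top]
      exact congrArg ModuleCat.Hom.hom this
    have h1 : (1 : R) ∈ T := by rw [hT]; trivial
    obtain ⟨l, hl, h1⟩ := (Submodule.mem_iSup_iff_exists_finsupp _ _).1 h1
    choose x hx using hl
    let e := l.support.equivFin
    refine similar_of_sum_eq_one hp (fun k => (e.symm k : M →ₗ[R] R)) (fun k => x (e.symm k)) ?_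
    refine Eq.trans ?_ ((Finset.sum_coe_sort l.support fun f => l f).trans h1)
    simp only [hx]
    exact Fintype.sum_equiv e.symm _ _ fun _ => rfl
  · intro h
    have hp := fgProjective_iff_isSummandOfPower.2 h.1
    refine ⟨(finitelyGeneratedObject_iff R M).2 hp.1, (IsProjective.iff_projective M).1 hp.2,
      (isSeparator_def _).2 fun X Y f g hfg => ?_⟩
    obtain ⟨n, φ, x, hx⟩ := h.exists_sum_eq_one
    ext y
    -- Each y is Σ φ_k(x_k) y, a sum of values of maps M → X, and f and g agree on such values.
    have key : ∀ k, f.hom (φ k (x k) • y) = g.hom (φ k (x k) • y) := fun k =>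
      LinearMap.congr_fun (congrArg ModuleCat.Hom.hom
        (hfg (ModuleCat.ofHom (LinearMap.toSpanSingleton R X y ∘ₗ φ k)))) (x k)
    rw [← one_smul R y, ← hx, Finset.sum_smul, map_sum, map_sum]
    exact Finset.sum_congr rfl fun k _ => key k

end Progenerators

/-- The regular right module of a ring, as a left module over the opposite ring. -/
def opEquiv (R : Type u) [Ring R] : R ≃ₗ[Rᵐᵒᵖ] Rᵐᵒᵖ where
  toFun := op
  invFun := unop
  map_add' _ _ := rfl
  map_smul' _ _ := rfl
  left_inv _ := rfl
  right_inv _ := rfl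

lemma BT.exists_sum {R M N : Type u} [Ring R] [AddCommGroup M] [AddCommGroup N] [Module Rᵐᵒᵖ M]
    [Module R N] (t : BT R M N) :
    ∃ (n : ℕ) (x : Fin n → M) (y : Fin n → N), t = ∑ k, BT.tmul R (x k) (y k) := by
  induction t using BT.induction with
  | h0 => exact ⟨0, Fin.elim0, Fin.elim0, by simp⟩
  | ht m n => exact ⟨1, fun _ => m, fun _ => n, by simp⟩
  | ha s t hs ht =>
    obtain ⟨k, x, y, rfl⟩ := hs
    obtain ⟨l, x', y', rfl⟩ := ht
    exact ⟨k + l, Fin.append x x', Fin.append y y', by simp [Fin.sum_univ_add]⟩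

/-! ### Symmetry and surjectivity in Morita contexts -/

namespace MoritaContext

variable {R S P Q : Type u} [Ring R] [Ring S] [AddCommGroup P] [AddCommGroup Q]
    [Module R P] [Module Sᵐᵒᵖ P] [SMulCommClass R Sᵐᵒᵖ P]
    [Module S Q] [Module Rᵐᵒᵖ Q] [SMulCommClass S Rᵐᵒᵖ Q] (K : MoritaContext R S P Q)

/-- The Morita context with the roles of the two rings exchanged. -/
def swap : MoritaContext S R Q P where
  μ := K.τ
  τ := K.μ
  μ_smul := K.τ_smul
  μ_op_smul := K.τ_op_smul
  τ_smul := K.μ_smul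
  τ_op_smul := K.μ_op_smul
  μ_τ := K.τ_μ
  τ_μ := K.μ_τ

/-- The image of μ is an ideal, so surjectivity is the finite datum of an expression of 1. All later
arguments use it in this form. -/
lemma μ_surjective_iff : Function.Surjective K.μ ↔
    ∃ (n : ℕ) (p : Fin n → P) (q : Fin n → Q), ∑ k, K.μ (BT.tmul S (p k) (q k)) = 1 := by
  constructor
  · intro h
    obtain ⟨t, ht⟩ := h 1
    obtain ⟨n, p, q, rfl⟩ := t.exists_sum
    exact ⟨n, p, q, by rw [← ht, map_sum]⟩
  · rintro ⟨n, p, q, h⟩ r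
    exact ⟨r • ∑ k, BT.tmul S (p k) (q k), by rw [K.μ_smul, map_sum, h, smul_eq_mul, mul_one]⟩

lemma τ_surjective_iff : Function.Surjective K.τ ↔
    ∃ (n : ℕ) (q : Fin n → Q) (p : Fin n → P), ∑ k, K.τ (BT.tmul R (q k) (p k)) = 1 :=
  K.swap.μ_surjective_iff

end MoritaContext

/-! ### Compatibility of the A-actions with the dual rings -/

section Scalars

variable (A C : Type u) [Ring A] [AddCommGroup C] [Module A C] [Module Aᵐᵒᵖ C]
    [SMulCommClass A Aᵐᵒᵖ C]

/-- `C*` is a left `A`-module by `(a f)(c) = a f(c)`. -/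
instance : Module A (RightDual A C) := inferInstanceAs (Module A (C →ₗ[Aᵐᵒᵖ] A))

variable {A C} in
@[simp] lemma RightDual.smul_lin (a : A) (f : RightDual A C) (c : C) :
    (a • f).lin c = a • f.lin c := rfl

variable [Coring A C]

/-- The towers over A make every map that is linear over a dual ring also linear over A. -/
instance : IsScalarTower A (RightDual A C) C where
  smul_assoc a f c := by
    change BT.lsmul _ (Coring.comulR A C c) = a • BT.lsmul _ (Coring.comulR A C c)
    induction Coring.comulR A C c using BT.induction with
    | h0 => simp
    | ht x y => exact mul_smul a (f.lin x) y
    | ha x y hx hy => rw [map_add, map_add, hx, hy, smul_add]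

instance : IsScalarTower A (RightDual A C) (RightDual A C) where
  smul_assoc _ _ _ := rfl

instance : IsScalarTower Aᵐᵒᵖ (LeftDual A C)ᵐᵒᵖ C where
  smul_assoc a f c := by
    change BT.rsmul _ (Coring.comulL A C c) = a • BT.rsmul _ (Coring.comulL A C c)
    induction Coring.comulL A C c using BT.induction with
    | h0 => simp
    | ht x y => exact mul_smul a (op (f.unop.lin y)) x
    | ha x y hx hy => rw [map_add, map_add, hx, hy, smul_add]

instance : IsScalarTower Aᵐᵒᵖ (LeftDual A C)ᵐᵒᵖ (LeftDual A C) where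
  smul_assoc _ _ _ := rfl

instance : IsScalarTower Aᵐᵒᵖ (LeftDual A C)ᵐᵒᵖ (LeftDual A C)ᵐᵒᵖ where
  smul_assoc _ _ _ := rfl

end Scalars

/-! ### Strictness and the two readings of Q -/

section QuasiFrobenius

variable {A C : Type u} [Ring A] [AddCommGroup C] [Module A C] [Module Aᵐᵒᵖ C]
    [SMulCommClass A Aᵐᵒᵖ C]

/-- For a left `A`-linear map `q : C → C*` and `c ∈ C`, the element `x ↦ q(x)(c)` of `*C`. -/
def evalRightDual (q : C →ₗ[A] RightDual A C) (c : C) : LeftDual A C :=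
  ({ toFun := fun x => (q x).lin c
     map_add' := fun x y => by rw [map_add, RightDual.add_lin]
     map_smul' := fun a x => by rw [map_smul, RightDual.smul_lin, RingHom.id_apply] } : C →ₗ[A] A)

lemma sum_lin_left {ι : Type*} (s : Finset ι) (f : ι → LeftDual A C) (c : C) :
    (∑ k ∈ s, f k).lin c = ∑ k ∈ s, (f k).lin c :=
  map_sum ({ toFun := fun f => f.lin c, map_zero' := rfl, map_add' := fun _ _ => rfl } :
    LeftDual A C →+ A) f s

lemma sum_lin_right {ι : Type*} (s : Finset ι) (f : ι → RightDual A C) (c : C) :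
    (∑ k ∈ s, f k).lin c = ∑ k ∈ s, (f k).lin c :=
  map_sum ({ toFun := fun f => f.lin c, map_zero' := rfl, map_add' := fun _ _ => rfl } :
    RightDual A C →+ A) f s

lemma leftDual_separates (h : WeaklyLocallyProjective A C) (c : C)
    (hc : ∀ f : LeftDual A C, f.lin c = 0) : c = 0 :=
  h.eq_zero c hc

lemma rightDual_separates (h : WeaklyLocallyProjective Aᵐᵒᵖ C) (c : C)
    (hc : ∀ f : RightDual A C, f.lin c = 0) : c = 0 :=
  h.eq_zero c fun f => op_injective.eq_iff.1 <| by
    exact congrArg op (congrArg op (hc ((opEquiv A).symm.toLinearMap ∘ₗ f)))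

variable [Coring A C]

/-- With x_k = g_k(1), the splitting reads c = Σ x_k · φ_k(c). Writing Δ(x_k) as a finite sum Σ x ⊗
y turns this into c = Σ x φ_k(c)(y), a dual basis whose coordinates c ↦ φ_k(c)(y) are right
A-linear. -/
lemma fgProjective_op_of_isSummandOfPower
    (h : IsSummandOfPower (LeftDual A C)ᵐᵒᵖ C (LeftDual A C)) : FGProjective Aᵐᵒᵖ C := by
  obtain ⟨n, φ, g, h⟩ := isSummandOfPower_iff.1 h
  choose m x y hxy using fun k => BT.exists_sum (Coring.comulL A C (g k 1))
  refine FGProjective.of_dual_basis (ι := Σ k : Fin n, Fin (m k))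
    (fun i => (opEquiv A).toLinearMap ∘ₗ
      (evalQ ((φ i.1).restrictScalars Aᵐᵒᵖ) (y i.1 i.2)).lin) (fun i => x i.1 i.2) fun c => ?_
  rw [Fintype.sum_sigma]
  conv_rhs => rw [← h c]
  refine Finset.sum_congr rfl fun k _ => ?_
  have h1 : g k (φ k c) = op (φ k c) • g k 1 := by
    rw [← map_smul, op_smul_eq_mul, one_mul]
  rw [h1]
  change _ = BT.rsmul (φ k c).lin (Coring.comulL A C (g k 1))
  rw [hxy, map_sum]
  rfl

/-- Mirror image: from c = Σ φ_k(c) · x_k with Δ(x_k) = Σ x ⊗ y one gets c = Σ φ_k(c)(x) y. -/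
lemma fgProjective_of_isSummandOfPower
    (h : IsSummandOfPower (RightDual A C) C (RightDual A C)) : FGProjective A C := by
  obtain ⟨n, φ, g, h⟩ := isSummandOfPower_iff.1 h
  choose m x y hxy using fun k => BT.exists_sum (Coring.comulR A C (g k 1))
  refine FGProjective.of_dual_basis (ι := Σ k : Fin n, Fin (m k))
    (fun i => (evalRightDual ((φ i.1).restrictScalars A) (x i.1 i.2)).lin)
    (fun i => y i.1 i.2) fun c => ?_
  rw [Fintype.sum_sigma]
  conv_rhs => rw [← h c]
  refine Finset.sum_congr rfl fun k _ => ?_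
  have h1 : g k (φ k c) = φ k c • g k 1 := by
    rw [← map_smul, smul_eq_mul, mul_one]
  rw [h1]
  change _ = BT.lsmul (φ k c).lin (Coring.comulR A C (g k 1))
  rw [hxy, map_sum]
  rfl

/-- Elements of `Q` as right `*C`-linear maps `C → *C`. -/
def moritaQ.toRight (q : moritaQ A C) : C →ₗ[(LeftDual A C)ᵐᵒᵖ] LeftDual A C where
  toFun := q.1
  map_add' := map_add q.1
  map_smul' f x := moritaQ_op_smul q f.unop x

/-- Elements of `Q` as left `C*`-linear maps `C → C*`. -/
def moritaQ.toLeft (q : moritaQ A C) : C →ₗ[RightDual A C] RightDual A C where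
  toFun := evalQ q.1
  map_add' x y := RightDual.ext fun c => map_add (q.1 c).lin x y
  map_smul' r x := by
    have := (coringContext A C).μ_smul r (BT.tmul _ x q)
    exact this

/-- Right `*C`-linear maps `C → *C` belong to `Q` if `*C` separates the points of `C`. -/
def moritaQ.ofRight (hsep : ∀ c : C, (∀ f : LeftDual A C, f.lin c = 0) → c = 0)
    (φ : C →ₗ[(LeftDual A C)ᵐᵒᵖ] LeftDual A C) : moritaQ A C :=
  ⟨φ.restrictScalars Aᵐᵒᵖ, fun x c => sub_eq_zero.1 <| hsep _ fun f => by
    rw [map_sub, sub_eq_zero]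
    -- Applying f to the two sides of the defining identity of Q gives φ(x · f)(c) and (φ(x) *
    -- f)(c), so the identity is *C-linearity as seen by functionals.
    have h1 := congrArg (fun g : LeftDual A C => g.lin c) (φ.map_smul (op f) x)
    refine Eq.trans ?_ h1
    change _ = ((φ.restrictScalars Aᵐᵒᵖ) (BT.rsmul f.lin (Coring.comulR A C x))).lin c
    change f.lin (BT.lsmul _ (Coring.comulR A C x)) = _
    induction Coring.comulR A C x using BT.induction with
    | h0 => simp
    | ht u v =>
      rw [BT.lsmul_tmul, BT.rsmul_tmul, map_smul, map_smul]; rfl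
    | ha u v hu hv => simp only [map_add, LeftDual.add_lin, hu, hv]⟩

/-- Left `C*`-linear maps `C → C*` give elements of `Q` if `C*` separates the points of `C`. -/
def moritaQ.ofLeft (hsep : ∀ c : C, (∀ f : RightDual A C, f.lin c = 0) → c = 0)
    (ψ : C →ₗ[RightDual A C] RightDual A C) : moritaQ A C :=
  ⟨{ toFun := evalRightDual (ψ.restrictScalars A)
     map_add' := fun x y => LeftDual.ext fun c => map_add (ψ c).lin x y
     map_smul' := fun a x => LeftDual.ext fun c => map_smul (ψ c).lin a x },
    fun x c => sub_eq_zero.1 <| hsep _ fun f => by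
    rw [map_sub, sub_eq_zero]
    -- Here f turns the two sides into (f * ψ(c))(x) and ψ(f · c)(x).
    have h1 := congrArg (fun g : RightDual A C => g.lin x) (ψ.map_smul f c)
    refine Eq.trans h1.symm ?_
    change ((ψ.restrictScalars A) (BT.lsmul f.lin (Coring.comulL A C c))).lin x =
      f.lin (BT.rsmul (evalRightDual (ψ.restrictScalars A) x).lin (Coring.comulL A C c))
    induction Coring.comulL A C c using BT.induction with
    | h0 => simp
    | ht u v =>
      rw [BT.lsmul_tmul, BT.rsmul_tmul, map_smul, map_smul]; rfl
    | ha u v hu hv => simp only [map_add, RightDual.add_lin, hu, hv]⟩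

/-- The first reading of Σ x_k ▽ q_k = ε: applying ε to c = Σ x_k · φ_k(c) gives Σ φ_k(c)(x_k) =
ε(c), because ε(x · f) = f(x). -/
lemma μ_surjective_of_right (hsep : ∀ c : C, (∀ f : LeftDual A C, f.lin c = 0) → c = 0)
    (h : IsSummandOfPower (LeftDual A C)ᵐᵒᵖ C (LeftDual A C)) :
    Function.Surjective (coringContext A C).μ := by
  obtain ⟨n, φ, g, h⟩ := isSummandOfPower_iff.1 h
  refine (coringContext A C).μ_surjective_iff.2
    ⟨n, fun k => g k 1, fun k => moritaQ.ofRight hsep (φ k), RightDual.ext fun c => ?_⟩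
  rw [sum_lin_right]
  change ∑ k, (φ k c).lin (g k 1) = (Coring.counitR A C).lin c
  have h1 : ∀ k, (φ k c).lin (g k 1) = Coring.counit (A := A) (g k (φ k c)) := fun k => by
    have h1 : g k (φ k c) = op (φ k c) • g k 1 := by
      rw [← map_smul, op_smul_eq_mul, one_mul]
    rw [h1]
    exact (Coring.counit_ract _ _).symm
  simp only [h1, ← map_sum, h]
  rfl

/-- The second reading: the maps C → C* in the splitting belong to Q, and composing with C* → C at 1
writes 1 as a value of μ. -/
lemma μ_surjective_of_left (hsep : ∀ c : C, (∀ f : RightDual A C, f.lin c = 0) → c = 0)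
    (h : IsSummandOfPower (RightDual A C) (RightDual A C) C) :
    Function.Surjective (coringContext A C).μ := by
  obtain ⟨n, φ, g, h⟩ := isSummandOfPower_iff.1 h
  exact (coringContext A C).μ_surjective_iff.2
    ⟨n, fun k => φ k 1, fun k => moritaQ.ofLeft hsep (g k), h 1⟩

/-- Here ε is applied to c = Σ φ_k(c) · y_k, using ε(f · y) = f(y). -/
lemma τ_surjective_of_left (hsep : ∀ c : C, (∀ f : RightDual A C, f.lin c = 0) → c = 0)
    (h : IsSummandOfPower (RightDual A C) C (RightDual A C)) :
    Function.Surjective (coringContext A C).τ := by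
  obtain ⟨n, φ, g, h⟩ := isSummandOfPower_iff.1 h
  refine (coringContext A C).τ_surjective_iff.2
    ⟨n, fun k => moritaQ.ofLeft hsep (φ k), fun k => g k 1, LeftDual.ext fun c => ?_⟩
  rw [sum_lin_left]
  change ∑ k, (φ k c).lin (g k 1) = (Coring.counitL A C).lin c
  have h1 : ∀ k, (φ k c).lin (g k 1) = Coring.counit (A := A) (g k (φ k c)) := fun k => by
    have h1 : g k (φ k c) = φ k c • g k 1 := by
      rw [← map_smul, smul_eq_mul, mul_one]
    rw [h1]
    exact (Coring.counit_lact _ _).symm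
  simp only [h1, ← map_sum, h]
  rfl

lemma τ_surjective_of_right (hsep : ∀ c : C, (∀ f : LeftDual A C, f.lin c = 0) → c = 0)
    (h : IsSummandOfPower (LeftDual A C)ᵐᵒᵖ (LeftDual A C) C) :
    Function.Surjective (coringContext A C).τ := by
  obtain ⟨n, φ, g, h⟩ := isSummandOfPower_iff.1 h
  exact (coringContext A C).τ_surjective_iff.2
    ⟨n, fun k => moritaQ.ofRight hsep (g k), fun k => φ k 1, h 1⟩

-- The converse of the four preceding lemmas. Each of the two expressions of 1 supplies a dual basis
-- over one dual ring and the generator property over the other.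
variable (A C) in
lemma similar_of_strict (h : (coringContext A C).Strict) :
    Similar (RightDual A C) C (RightDual A C) ∧
      Similar (LeftDual A C)ᵐᵒᵖ C (LeftDual A C) := by
  obtain ⟨n, x, q, hμ⟩ := (coringContext A C).μ_surjective_iff.1 h.1
  obtain ⟨m, r, y, hτ⟩ := (coringContext A C).τ_surjective_iff.1 h.2
  -- Let 1 = Σ x_k ▽ q_k act on c and use (x ▽ q) · c = x · q(c).
  have hμ' : ∀ c : C, ∑ k, op ((q k).1 c) • x k = c := fun c => by
    conv_rhs => rw [← one_smul (RightDual A C) c, ← hμ, Finset.sum_smul]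
    exact Finset.sum_congr rfl fun k _ => ((coringContext A C).μ_τ (x k) (q k) c).symm
  have hτ' : ∀ c : C, ∑ k, evalQ (r k).1 c • y k = c := fun c => by
    conv_rhs => rw [← one_smul (LeftDual A C)ᵐᵒᵖ c, ← op_one, ← hτ, Finset.op_sum, Finset.sum_smul]
    exact Finset.sum_congr rfl fun k _ => (coringContext A C).μ_τ c (r k) (y k)
  refine ⟨similar_of_sum_eq_one (.of_dual_basis (fun k => moritaQ.toLeft (r k)) y hτ')
    (fun k => moritaQ.toLeft (q k)) x hμ, Similar.of_equiv (opEquiv (LeftDual A C)).symm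
      (similar_of_sum_eq_one (.of_dual_basis
        (fun k => (opEquiv (LeftDual A C)).toLinearMap ∘ₗ moritaQ.toRight (q k)) x hμ')
        (fun k => (opEquiv (LeftDual A C)).toLinearMap ∘ₗ moritaQ.toRight (r k)) y ?_)⟩
  exact (Finset.op_sum _ _).symm.trans (congrArg op hτ)

end QuasiFrobenius

/-- The functor `P ⊗_S -` from left `S`-modules to left `R`-modules, for an `R`-`S` bimodule
`P`. -/
def bimoduleTensorLeft (R S P : Type u) [Ring R] [Ring S] [AddCommGroup P] [Module R P]
    [Module Sᵐᵒᵖ P] [SMulCommClass R Sᵐᵒᵖ P] : ModuleCat.{u} S ⥤ ModuleCat.{u} R where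
  obj N := ModuleCat.of R (BT S P N)
  map f := ModuleCat.ofHom { BT.map (LinearMap.id (R := Sᵐᵒᵖ) (M := P)) f.hom with
    map_smul' := BT.map_smul _ _ (fun _ _ => rfl) }
  map_id N := by
    ext t
    change BT.map _ _ t = t
    induction t using BT.induction with
    | h0 => simp
    | ht m n => rfl
    | ha x y hx hy => rw [map_add, hx, hy]
  map_comp f g := by
    ext t
    change BT.map _ _ t = BT.map _ _ (BT.map _ _ t)
    induction t using BT.induction with
    | h0 => simp
    | ht m n => rfl
    | ha x y hx hy => rw [map_add, map_add, map_add, hx, hy]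

namespace BT

variable {R S M N P : Type u} [Ring R] [Ring S] [AddCommGroup M] [AddCommGroup N]
  [AddCommGroup P] [Module Rᵐᵒᵖ M] [Module R N] [Module Sᵐᵒᵖ N] [SMulCommClass R Sᵐᵒᵖ N]
  [Module S P]

lemma induction_left {p : BT S (BT R M N) P → Prop} (t : BT S (BT R M N) P) (h0 : p 0)
    (ht : ∀ x y z, p (tmul S (tmul R x y) z)) (ha : ∀ x y, p x → p y → p (x + y)) : p t := by
  induction t using BT.induction with
  | h0 => exact h0
  | ht s z =>
    induction s using BT.induction with
    | h0 => rwa [zero_tmul]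
    | ht x y => exact ht x y z
    | ha x y hx hy => rw [add_tmul]; exact ha _ _ hx hy
  | ha x y hx hy => exact ha _ _ hx hy

lemma induction_right {p : BT R M (BT S N P) → Prop} (t : BT R M (BT S N P)) (h0 : p 0)
    (ht : ∀ x y z, p (tmul R x (tmul S y z))) (ha : ∀ x y, p x → p y → p (x + y)) : p t := by
  induction t using BT.induction with
  | h0 => exact h0
  | ht x s =>
    induction s using BT.induction with
    | h0 => rwa [tmul_zero]
    | ht y z => exact ht x y z
    | ha y z hy hz => rw [tmul_add]; exact ha _ _ hy hz
  | ha x y hx hy => exact ha _ _ hx hy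

end BT

/-! ### Morita equivalence and faithful flatness for an arbitrary context -/

namespace MoritaContext

variable {R S P Q : Type u} [Ring R] [Ring S] [AddCommGroup P] [AddCommGroup Q]
    [Module R P] [Module Sᵐᵒᵖ P] [SMulCommClass R Sᵐᵒᵖ P]
    [Module S Q] [Module Rᵐᵒᵖ Q] [SMulCommClass S Rᵐᵒᵖ Q] (K : MoritaContext R S P Q)

/-- The map `(N ⊗_R P) ⊗_S Q → N`, `(n ⊗ p) ⊗ q ↦ n μ(p ⊗ q)`. -/
def contractRight (N : Type u) [AddCommGroup N] [Module Rᵐᵒᵖ N] :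
    BT S (BT R N P) Q →ₗ[Rᵐᵒᵖ] N :=
  { (BT.rsmul (LinearMap.id (R := R) (M := R))).comp ((BT.map (LinearMap.id (R := Rᵐᵒᵖ) (M := N))
      ({ K.μ with map_smul' := K.μ_smul } : BT S P Q →ₗ[R] R)).comp BT.assoc) with
    map_smul' := fun r t => by
      induction t using BT.induction_left with
      | h0 => simp
      | ht n p q =>
        change op (K.μ (op r.unop • BT.tmul S p q)) • n = r • op (K.μ (BT.tmul S p q)) • n
        rw [K.μ_op_smul, ← mul_smul]
        rfl
      | ha x y hx hy => rw [smul_add]; simp only [ZeroHom.toFun_eq_coe, AddMonoidHom.toZeroHom_coe,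
          RingHom.id_apply] at *; rw [map_add, hx, hy, map_add, smul_add] }

/-- The map `P ⊗_S (Q ⊗_R N) → N`, `p ⊗ (q ⊗ n) ↦ μ(p ⊗ q) n`. -/
def contractLeft (N : Type u) [AddCommGroup N] [Module R N] :
    BT S P (BT R Q N) →ₗ[R] N :=
  { (BT.lsmul (LinearMap.id (R := Rᵐᵒᵖ) (M := R))).comp ((BT.map
      ({ K.μ with map_smul' := K.μ_op_smul } : BT S P Q →ₗ[Rᵐᵒᵖ] R)
      (LinearMap.id (R := R) (M := N))).comp BT.assocInv) with
    map_smul' := fun r t => by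
      induction t using BT.induction_right with
      | h0 => simp
      | ht p q n =>
        change K.μ (r • BT.tmul S p q) • n = r • K.μ (BT.tmul S p q) • n
        rw [K.μ_smul, ← mul_smul]
        rfl
      | ha x y hx hy => rw [smul_add]; simp only [ZeroHom.toFun_eq_coe, AddMonoidHom.toZeroHom_coe,
          RingHom.id_apply] at *; rw [map_add, hx, hy, map_add, smul_add] }

lemma contractRight_tmul {N : Type u} [AddCommGroup N] [Module Rᵐᵒᵖ N] (n : N) (p : P) (q : Q) :
    K.contractRight N (BT.tmul S (BT.tmul R n p) q) = op (K.μ (BT.tmul S p q)) • n :=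
  rfl

lemma contractLeft_tmul {N : Type u} [AddCommGroup N] [Module R N] (n : N) (p : P) (q : Q) :
    K.contractLeft N (BT.tmul S p (BT.tmul R q n)) = K.μ (BT.tmul S p q) • n :=
  rfl

/-- Surjectivity of μ alone suffices: an expression 1 = Σ μ(x_k ⊗ y_k) gives the inverse n ↦ Σ (n ⊗
x_k) ⊗ y_k, which by the Morita identities does not need injectivity of μ as a hypothesis. -/
lemma contractRight_bijective (h : Function.Surjective K.μ) (N : Type u) [AddCommGroup N]
    [Module Rᵐᵒᵖ N] : Function.Bijective (K.contractRight N) := by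
  obtain ⟨m, x, y, h⟩ := K.μ_surjective_iff.1 h
  let g : N →+ BT S (BT R N P) Q := AddMonoidHom.mk'
    (fun n => ∑ k, BT.tmul S (BT.tmul R n (x k)) (y k))
    (fun n n' => by simp only [BT.add_tmul, Finset.sum_add_distrib])
  refine Function.bijective_iff_has_inverse.2 ⟨g, fun t => ?_, fun n => ?_⟩
  · induction t using BT.induction_left with
    | h0 => simp
    | ht n p q =>
      rw [contractRight_tmul]
      change ∑ k, BT.tmul S (BT.tmul R (op (K.μ (BT.tmul S p q)) • n) (x k)) (y k) = _
      -- The scalar μ(p ⊗ q) moves across both tensor signs: n μ(p ⊗ q) ⊗ x_k ⊗ y_k = n ⊗ p τ(q ⊗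
      -- x_k) ⊗ y_k = n ⊗ p ⊗ q μ(x_k ⊗ y_k).
      have h1 : ∀ k, BT.tmul S (BT.tmul R (op (K.μ (BT.tmul S p q)) • n) (x k)) (y k) =
          BT.tmul S (BT.tmul R n p) (op (K.μ (BT.tmul S (x k) (y k))) • q) := fun k => by
        rw [BT.smul_tmul, K.μ_τ, ← BT.smul_right_tmul, BT.smul_tmul, K.τ_μ]
      have h2 : ∑ k, op (K.μ (BT.tmul S (x k) (y k))) • q = q := by
        rw [← Finset.sum_smul, ← Finset.op_sum, h, op_one, one_smul]
      simp only [h1]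
      conv_rhs => rw [← h2]
      exact (map_sum (AddMonoidHom.mk' (BT.tmul S (BT.tmul R n p)) (BT.tmul_add _)) _ _).symm
    | ha s t hs ht => rw [map_add, map_add, hs, ht]
  · change K.contractRight N (∑ k, BT.tmul S (BT.tmul R n (x k)) (y k)) = n
    simp only [map_sum, contractRight_tmul]
    rw [← Finset.sum_smul, ← Finset.op_sum, h, op_one, one_smul]

lemma contractLeft_bijective (h : Function.Surjective K.μ) (N : Type u) [AddCommGroup N]
    [Module R N] : Function.Bijective (K.contractLeft N) := by
  obtain ⟨m, x, y, h⟩ := K.μ_surjective_iff.1 h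
  let g : N →+ BT S P (BT R Q N) := AddMonoidHom.mk'
    (fun n => ∑ k, BT.tmul S (x k) (BT.tmul R (y k) n))
    (fun n n' => by simp only [BT.tmul_add, Finset.sum_add_distrib])
  refine Function.bijective_iff_has_inverse.2 ⟨g, fun t => ?_, fun n => ?_⟩
  · induction t using BT.induction_right with
    | h0 => simp
    | ht p q n =>
      rw [contractLeft_tmul]
      change ∑ k, BT.tmul S (x k) (BT.tmul R (y k) (K.μ (BT.tmul S p q) • n)) = _
      have h1 : ∀ k, BT.tmul S (x k) (BT.tmul R (y k) (K.μ (BT.tmul S p q) • n)) =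
          BT.tmul S (K.μ (BT.tmul S (x k) (y k)) • p) (BT.tmul R q n) := fun k => by
        rw [← BT.smul_tmul, ← K.τ_μ, ← BT.smul_left_tmul, ← BT.smul_tmul, K.μ_τ]
      have h2 : ∑ k, K.μ (BT.tmul S (x k) (y k)) • p = p := by
        rw [← Finset.sum_smul, h, one_smul]
      simp only [h1]
      conv_rhs => rw [← h2]
      exact (map_sum (AddMonoidHom.mk' (fun p => BT.tmul S p (BT.tmul R q n))
        (fun p p' => BT.add_tmul p p' _)) _ _).symm
    | ha s t hs ht => rw [map_add, map_add, hs, ht]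
  · change K.contractLeft N (∑ k, BT.tmul S (x k) (BT.tmul R (y k) n)) = n
    simp only [map_sum, contractLeft_tmul]
    rw [← Finset.sum_smul, h, one_smul]

lemma contractRight_naturality {N N' : Type u} [AddCommGroup N] [AddCommGroup N']
    [Module Rᵐᵒᵖ N] [Module Rᵐᵒᵖ N'] (f : N →ₗ[Rᵐᵒᵖ] N')
    (g : BT R N P →ₗ[Sᵐᵒᵖ] BT R N' P) (hg : ∀ n p, g (BT.tmul R n p) = BT.tmul R (f n) p)
    (t : BT S (BT R N P) Q) :
    K.contractRight N' (BT.map g LinearMap.id t) = f (K.contractRight N t) := by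
  induction t using BT.induction_left with
  | h0 => simp
  | ht n p q =>
    rw [contractRight_tmul, map_smul, BT.map_tmul, hg]
    rfl
  | ha s t hs ht => rw [map_add, map_add, map_add, map_add, hs, ht]

lemma contractLeft_naturality {N N' : Type u} [AddCommGroup N] [AddCommGroup N']
    [Module R N] [Module R N'] (f : N →ₗ[R] N')
    (g : BT R Q N →ₗ[S] BT R Q N') (hg : ∀ q n, g (BT.tmul R q n) = BT.tmul R q (f n))
    (t : BT S P (BT R Q N)) :
    K.contractLeft N' (BT.map LinearMap.id g t) = f (K.contractLeft N t) := by
  induction t using BT.induction_right with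
  | h0 => simp
  | ht p q n =>
    rw [contractLeft_tmul, map_smul, BT.map_tmul, hg]
    rfl
  | ha s t hs ht => rw [map_add, map_add, map_add, map_add, hs, ht]

/-- `(- ⊗_R P) ⊗_S Q` is isomorphic to the identity functor if `μ` is surjective. -/
def contractRightIso (h : Function.Surjective K.μ) :
    bimoduleTensor R S P ⋙ bimoduleTensor S R Q ≅ 𝟭 _ :=
  NatIso.ofComponents
    (fun N => (LinearEquiv.ofBijective _ (K.contractRight_bijective h N)).toModuleIso)
    (fun f => ModuleCat.hom_ext (LinearMap.ext
      (K.contractRight_naturality f.hom ((bimoduleTensor R S P).map f).hom fun _ _ => rfl)))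

/-- `P ⊗_S (Q ⊗_R -)` is isomorphic to the identity functor if `μ` is surjective. -/
def contractLeftIso (h : Function.Surjective K.μ) :
    bimoduleTensorLeft S R Q ⋙ bimoduleTensorLeft R S P ≅ 𝟭 _ :=
  NatIso.ofComponents
    (fun N => (LinearEquiv.ofBijective _ (K.contractLeft_bijective h N)).toModuleIso)
    (fun f => ModuleCat.hom_ext (LinearMap.ext
      (K.contractLeft_naturality f.hom ((bimoduleTensorLeft S R Q).map f).hom fun _ _ => rfl)))

variable {K}

/-- Tensoring with Q is the quasi-inverse; the second isomorphism is the contraction of the swapped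
context. -/
lemma Strict.isEquivalence_bimoduleTensor (h : K.Strict) :
    (bimoduleTensor R S P).IsEquivalence :=
  (CategoryTheory.Equivalence.mk (bimoduleTensor R S P) (bimoduleTensor S R Q)
    (K.contractRightIso h.1).symm (K.swap.contractRightIso h.2)).isEquivalence_functor

lemma Strict.isEquivalence_bimoduleTensorLeft (h : K.Strict) :
    (bimoduleTensorLeft R S P).IsEquivalence :=
  (CategoryTheory.Equivalence.mk (bimoduleTensorLeft R S P) (bimoduleTensorLeft S R Q)
    (K.swap.contractLeftIso h.2).symm (K.contractLeftIso h.1)).isEquivalence_functor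

/-- If `P` is faithful over `R` and `τ` is surjective, then so is `μ`: the tensor product of `P`
with the cokernel of `μ` vanishes. -/
lemma μ_surjective_of_faithfullyFlatLeft (hP : FaithfullyFlatLeft R P)
    (h : Function.Surjective K.τ) : Function.Surjective K.μ := by
  obtain ⟨m, y, x, hτ⟩ := K.τ_surjective_iff.1 h
  let I : Submodule Rᵐᵒᵖ R :=
    LinearMap.range ({ K.μ with map_smul' := K.μ_op_smul } : BT S P Q →ₗ[Rᵐᵒᵖ] R)
  have key : ∀ t : BT R (R ⧸ I) P, t = 0 := fun t => by
    induction t using BT.induction with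
    | h0 => rfl
    | ha s t hs ht => rw [hs, ht, add_zero]
    | ht z p =>
      obtain ⟨r, rfl⟩ := Submodule.mkQ_surjective I z
      -- Since Σ τ(y_k ⊗ x_k) = 1, the element p equals p Σ τ(y_k ⊗ x_k) = Σ μ(p ⊗ y_k) x_k. The
      -- coefficients lie in the image of μ, which is also a left ideal, so they kill r ⊗ p modulo
      -- I.
      have hp : ∑ k, K.μ (BT.tmul S p (y k)) • x k = p := by
        simp only [K.μ_τ]
        rw [← Finset.sum_smul, ← Finset.op_sum, hτ, op_one, one_smul]
      rw [← hp]
      refine (map_sum (AddMonoidHom.mk' (BT.tmul R (I.mkQ r)) (BT.tmul_add _)) _ _).trans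
        (Finset.sum_eq_zero fun k _ => ?_)
      change BT.tmul R (I.mkQ r) _ = 0
      rw [← BT.smul_tmul, ← map_smul, op_smul_eq_mul, ← smul_eq_mul, ← K.μ_smul]
      have h0 : I.mkQ (K.μ (r • BT.tmul S p (y k))) = 0 :=
        (Submodule.Quotient.mk_eq_zero I).2 ⟨_, rfl⟩
      rw [h0, BT.zero_tmul]
  -- The sequence of zero maps on R/I becomes exact after tensoring because everything is zero;
  -- reflected exactness says that R/I itself is zero.
  have hex := (hP (R ⧸ I) (R ⧸ I) (R ⧸ I) 0 0).2 fun t =>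
    ⟨fun _ => ⟨0, (map_zero _).trans (key t).symm⟩, fun _ => key _⟩
  intro r
  obtain ⟨_, h0⟩ := (hex (I.mkQ r)).1 rfl
  obtain ⟨t, ht⟩ := (Submodule.Quotient.mk_eq_zero I).1 h0.symm
  exact ⟨t, ht⟩

/-- If `P` is faithful over `S` and `μ` is surjective, then so is `τ`. -/
lemma τ_surjective_of_faithfullyFlatRight (hP : FaithfullyFlatRight S P)
    (h : Function.Surjective K.μ) : Function.Surjective K.τ := by
  obtain ⟨m, x, y, hμ⟩ := K.μ_surjective_iff.1 h
  let I : Submodule S S :=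
    LinearMap.range ({ K.τ with map_smul' := K.τ_smul } : BT R Q P →ₗ[S] S)
  have key : ∀ t : BT S P (S ⧸ I), t = 0 := fun t => by
    induction t using BT.induction with
    | h0 => rfl
    | ha s t hs ht => rw [hs, ht, add_zero]
    | ht p z =>
      obtain ⟨r, rfl⟩ := Submodule.mkQ_surjective I z
      have hp : ∑ k, op (K.τ (BT.tmul R (y k) p)) • x k = p := by
        simp only [← K.μ_τ]
        rw [← Finset.sum_smul, hμ, one_smul]
      rw [← hp]
      refine (map_sum (AddMonoidHom.mk' (fun p => BT.tmul S p (I.mkQ r))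
        (fun p p' => BT.add_tmul p p' _)) _ _).trans (Finset.sum_eq_zero fun k _ => ?_)
      change BT.tmul S _ (I.mkQ r) = 0
      have h1 : K.τ (BT.tmul R (y k) p) * r = K.τ (op r • BT.tmul R (y k) p) :=
        (K.τ_op_smul (op r) _).symm
      have h0 : I.mkQ (K.τ (op r • BT.tmul R (y k) p)) = 0 :=
        (Submodule.Quotient.mk_eq_zero I).2 ⟨_, rfl⟩
      rw [BT.smul_tmul, ← map_smul, smul_eq_mul, h1, h0, BT.tmul_zero]
  have hex := (hP (S ⧸ I) (S ⧸ I) (S ⧸ I) 0 0).2 fun t =>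
    ⟨fun _ => ⟨0, (map_zero _).trans (key t).symm⟩, fun _ => key _⟩
  intro r
  obtain ⟨_, h0⟩ := (hex (I.mkQ r)).1 rfl
  obtain ⟨t, ht⟩ := (Submodule.Quotient.mk_eq_zero I).1 h0.symm
  exact ⟨t, ht⟩

end MoritaContext

/-! ### Finite presentation from finiteness over the base ring -/

section FinitePresentation

/-- Projectivity over A splits a presentation Rⁿ → M only A-linearly. This still makes the kernel an
A-linear image of Rⁿ, hence finitely generated over A and so over R. -/
lemma FGProjective.finitePresentation {A R M : Type u} [Ring A] [Ring R] [AddCommGroup M]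
    [Module A R] [Module R M] [Module A M] [IsScalarTower A R R] [IsScalarTower A R M]
    (hM : FGProjective A M) (hR : Module.Finite A R) : Module.FinitePresentation R M := by
  have := hM.1
  have := hM.2
  have : Module.Finite R M := Module.Finite.of_restrictScalars_finite A R M
  obtain ⟨n, π, hπ⟩ := Module.Finite.exists_fin' R M
  obtain ⟨s, hs⟩ := Module.projective_lifting_property (π.restrictScalars A)
    (LinearMap.id (R := A) (M := M)) hπ
  have hs' : ∀ m, π (s m) = m := LinearMap.congr_fun hs
  refine Module.finitePresentation_of_surjective π hπ ?_
  have h : (LinearMap.ker π).restrictScalars A =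
      LinearMap.range (LinearMap.id - s ∘ₗ π.restrictScalars A) := by
    ext v
    constructor
    · intro hv
      refine ⟨v, ?_⟩
      have hv : π v = 0 := hv
      simp [hv]
    · rintro ⟨w, rfl⟩
      change π (w - s (π w)) = 0
      rw [map_sub, hs', sub_self]
  have : Module.Finite A (Fin n → R) := inferInstance
  refine Submodule.FG.of_restrictScalars (R := A) ?_
  rw [h, LinearMap.range_eq_map]
  exact this.fg_top.map _

end FinitePresentation

/-! ### Finitely presented flat modules are projective -/

section Flat

variable {R F : Type u} [Ring R] [AddCommGroup F]

/-- Only preservation of exactness is used. Dualizing a presentation Rᵐ → Rⁿ → F gives an exact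
sequence F^∨ → Rⁿ → Rᵐ of right modules, where F^∨ = Hom(F, R). Tensoring it with F lifts the
canonical element Σ e_j ⊗ a_j to F^∨ ⊗ F, and the lift is a dual basis. -/
lemma FaithfullyFlatLeft.fgProjective [Module R F] [Module.FinitePresentation R F]
    (hF : FaithfullyFlatLeft R F) : FGProjective R F := by
  obtain ⟨n, m, π, ρ, hπ, hρ⟩ := Module.FinitePresentation.exists_fin' R F
  let a : Fin n → F := fun j => π (Pi.single j 1)
  let r : Fin m → Fin n → R := fun i => ρ (Pi.single i 1)
  have hπa : ∀ v, π v = ∑ j, v j • a j := fun v => by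
    conv_lhs => rw [← Finset.univ_sum_single v]
    rw [map_sum]
    exact Finset.sum_congr rfl fun j _ => by rw [← map_smul, ← Pi.single_smul]; simp
  have hr : ∀ i, ∑ j, r i j • a j = 0 := fun i => by
    rw [← hπa]; exact hρ.apply_apply_eq_zero _
  let α : (F →ₗ[R] R) →ₗ[Rᵐᵒᵖ] (Fin n → R) :=
    { toFun := fun φ j => φ (a j)
      map_add' := fun _ _ => rfl
      map_smul' := fun _ _ => rfl }
  let β : (Fin n → R) →ₗ[Rᵐᵒᵖ] (Fin m → R) :=
    { toFun := fun y i => ∑ j, r i j • y j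
      map_add' := fun y z => funext fun i => by
        simp only [Pi.add_apply, smul_add, Finset.sum_add_distrib]
      map_smul' := fun s y => funext fun i => by
        simp only [Pi.smul_apply, Finset.smul_sum, smul_comm s, RingHom.id_apply] }
  have hex : Function.Exact α β := fun y => by
    constructor
    · intro hy
      -- A vector y killed by β respects the relations among the a_j, so the functional e_j ↦ y_j on
      -- Rⁿ descends to F = Rⁿ / ker π.
      let L : (Fin n → R) →ₗ[R] R := ∑ j, (LinearMap.toSpanSingleton R R (y j)) ∘ₗ LinearMap.proj j
      have hL : ∀ v, L v = ∑ j, v j • y j := fun v => by simp [L]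
      have hker : LinearMap.ker π ≤ LinearMap.ker L := fun v hv => by
        obtain ⟨w, rfl⟩ := (hρ v).1 hv
        rw [LinearMap.mem_ker, ← LinearMap.comp_apply]
        have : L ∘ₗ ρ = 0 := LinearMap.pi_ext' fun i => LinearMap.ext_ring <|
          (hL _).trans (congrFun hy i)
        rw [this, LinearMap.zero_apply]
      refine ⟨(LinearMap.ker π).liftQ L hker ∘ₗ (π.quotKerEquivOfSurjective hπ).symm.toLinearMap,
        funext fun j => ?_⟩
      have h1 : (π.quotKerEquivOfSurjective hπ).symm (a j) = (LinearMap.ker π).mkQ (Pi.single j 1) :=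
        (LinearEquiv.symm_apply_eq _).2 rfl
      change (LinearMap.ker π).liftQ L hker ((π.quotKerEquivOfSurjective hπ).symm (a j)) = y j
      rw [h1]
      simp [hL, Pi.single_apply]
    · rintro ⟨φ, rfl⟩
      refine funext fun i => ?_
      change ∑ j, r i j • φ (a j) = 0
      simp only [← map_smul, ← map_sum, hr, map_zero]
  -- The image of Σ e_j ⊗ a_j is Σ_i e_i ⊗ Σ_j r_ij a_j, and the inner sums are the relations.
  have ht : BT.map β LinearMap.id (∑ j, BT.tmul R (Pi.single j (1 : R)) (a j)) = 0 := by
    have h1 : ∀ j, β (Pi.single j 1) = ∑ i, op (r i j) • Pi.single i (1 : R) := fun j => by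
      ext i
      simp [β, Pi.single_apply]
    have h2 : ∀ j, BT.tmul R (β (Pi.single j 1)) (a j) =
        ∑ i, BT.tmul R (Pi.single i (1 : R)) (r i j • a j) := fun j => by
      rw [h1]
      simp only [← BT.smul_tmul]
      exact map_sum (AddMonoidHom.mk' (fun y : Fin m → R => BT.tmul R y (a j))
        fun y z => BT.add_tmul y z _) _ _
    have h3 : ∀ i, ∑ j, BT.tmul R (Pi.single i (1 : R) : Fin m → R) (r i j • a j) = 0 :=
      fun i => (map_sum (AddMonoidHom.mk' (BT.tmul R (Pi.single i (1 : R) : Fin m → R))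
        (BT.tmul_add _)) _ _).symm.trans (by
          rw [hr]; exact map_zero _)
    simp only [map_sum, BT.map_tmul, LinearMap.id_apply, h2]
    rw [Finset.sum_comm]
    exact Finset.sum_eq_zero fun i _ => h3 i
  obtain ⟨s, hs⟩ := ((hF _ _ _ α β).1 hex _).1 ht
  obtain ⟨l, φ, x, rfl⟩ := s.exists_sum
  refine .of_dual_basis φ x fun c => ?_
  -- Compare the j-th coordinates in Rⁿ ⊗ F. The resulting identity on the generators a_j extends to
  -- F by linearity.
  have key : ∀ j, ∑ k, φ k (a j) • x k = a j := fun j => by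
    have := congrArg (BT.lsmul (LinearMap.proj (R := Rᵐᵒᵖ) (φ := fun _ : Fin n => R) j)) hs
    simpa [α, Pi.single_apply] using this
  obtain ⟨v, rfl⟩ := hπ c
  simp only [hπa, map_sum, Finset.sum_smul, map_smul, smul_eq_mul, mul_smul]
  rw [Finset.sum_comm]
  simp only [← Finset.smul_sum, key]

/-- The same argument on the other side, with Hom(F, R) as a left R-module. -/
lemma FaithfullyFlatRight.fgProjective [Module Rᵐᵒᵖ F] [Module.FinitePresentation Rᵐᵒᵖ F]
    (hF : FaithfullyFlatRight R F) : FGProjective Rᵐᵒᵖ F := by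
  obtain ⟨n, m, π, ρ, hπ, hρ⟩ := Module.FinitePresentation.exists_fin' Rᵐᵒᵖ F
  let a : Fin n → F := fun j => π (Pi.single j 1)
  let r : Fin m → Fin n → Rᵐᵒᵖ := fun i => ρ (Pi.single i 1)
  have hπa : ∀ v, π v = ∑ j, v j • a j := fun v => by
    conv_lhs => rw [← Finset.univ_sum_single v]
    rw [map_sum]
    exact Finset.sum_congr rfl fun j _ => by rw [← map_smul, ← Pi.single_smul]; simp
  have hr : ∀ i, ∑ j, r i j • a j = 0 := fun i => by
    rw [← hπa]; exact hρ.apply_apply_eq_zero _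
  let α : (F →ₗ[Rᵐᵒᵖ] R) →ₗ[R] (Fin n → R) :=
    { toFun := fun φ j => φ (a j)
      map_add' := fun _ _ => rfl
      map_smul' := fun _ _ => rfl }
  let β : (Fin n → R) →ₗ[R] (Fin m → R) :=
    { toFun := fun y i => ∑ j, r i j • y j
      map_add' := fun y z => funext fun i => by
        simp only [Pi.add_apply, smul_add, Finset.sum_add_distrib]
      map_smul' := fun s y => funext fun i => by
        simp only [Pi.smul_apply, Finset.smul_sum, smul_comm s, RingHom.id_apply] }
  have hex : Function.Exact α β := fun y => by
    constructor
    · intro hy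
      let L : (Fin n → Rᵐᵒᵖ) →ₗ[Rᵐᵒᵖ] R :=
        ∑ j, (LinearMap.toSpanSingleton Rᵐᵒᵖ R (y j)) ∘ₗ LinearMap.proj j
      have hL : ∀ v, L v = ∑ j, v j • y j := fun v => by
        simp only [L, LinearMap.sum_apply]; rfl
      have hker : LinearMap.ker π ≤ LinearMap.ker L := fun v hv => by
        obtain ⟨w, rfl⟩ := (hρ v).1 hv
        rw [LinearMap.mem_ker, ← LinearMap.comp_apply]
        have : L ∘ₗ ρ = 0 := LinearMap.pi_ext' fun i => LinearMap.ext_ring <|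
          (hL _).trans (congrFun hy i)
        rw [this, LinearMap.zero_apply]
      refine ⟨(LinearMap.ker π).liftQ L hker ∘ₗ (π.quotKerEquivOfSurjective hπ).symm.toLinearMap,
        funext fun j => ?_⟩
      have h1 : (π.quotKerEquivOfSurjective hπ).symm (a j) = (LinearMap.ker π).mkQ (Pi.single j 1) :=
        (LinearEquiv.symm_apply_eq _).2 rfl
      change (LinearMap.ker π).liftQ L hker ((π.quotKerEquivOfSurjective hπ).symm (a j)) = y j
      rw [h1]
      simp [hL, Pi.single_apply, ite_smul]
    · rintro ⟨φ, rfl⟩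
      refine funext fun i => ?_
      change ∑ j, r i j • φ (a j) = 0
      simp only [← map_smul, ← map_sum, hr, map_zero]
  have ht : BT.map LinearMap.id β (∑ j, BT.tmul R (a j) (Pi.single j (1 : R))) = 0 := by
    have h1 : ∀ j, β (Pi.single j 1) = ∑ i, (r i j).unop • Pi.single i (1 : R) := fun j => by
      ext i
      simp [β, Pi.single_apply]
    have h2 : ∀ j, BT.tmul R (a j) (β (Pi.single j 1)) =
        ∑ i, BT.tmul R (r i j • a j) (Pi.single i (1 : R)) := fun j => by
      rw [h1]
      refine (map_sum (AddMonoidHom.mk' (BT.tmul R (a j)) (BT.tmul_add _)) _ _).trans ?_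
      exact Finset.sum_congr rfl fun i _ => (BT.smul_tmul _ _ _).symm
    have h3 : ∀ i, ∑ j, BT.tmul R (r i j • a j) (Pi.single i (1 : R) : Fin m → R) = 0 :=
      fun i => (map_sum (AddMonoidHom.mk'
        (fun y => BT.tmul R y (Pi.single i (1 : R) : Fin m → R))
        fun y z => BT.add_tmul y z _) _ _).symm.trans (by
          rw [hr]; exact map_zero _)
    simp only [map_sum, BT.map_tmul, LinearMap.id_apply, h2]
    rw [Finset.sum_comm]
    exact Finset.sum_eq_zero fun i _ => h3 i
  obtain ⟨s, hs⟩ := ((hF _ _ _ α β).1 hex _).1 ht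
  obtain ⟨l, x, φ, rfl⟩ := s.exists_sum
  refine .of_dual_basis (fun k => (opEquiv R).toLinearMap ∘ₗ φ k) x fun c => ?_
  change ∑ k, op (φ k c) • x k = c
  have key : ∀ j, ∑ k, op (φ k (a j)) • x k = a j := fun j => by
    have := congrArg (BT.rsmul (LinearMap.proj (R := R) (φ := fun _ : Fin n => R) j)) hs
    simpa [α, Pi.single_apply, apply_ite op, ite_smul] using this
  obtain ⟨v, rfl⟩ := hπ c
  simp only [hπa, map_sum, Finset.sum_smul, map_smul, Finset.op_sum]
  rw [Finset.sum_comm]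
  refine Finset.sum_congr rfl fun j _ => ?_
  conv_rhs => rw [← key, Finset.smul_sum]
  exact Finset.sum_congr rfl fun k _ => mul_smul (v j) (op (φ k (a j))) (x k)

end Flat

/-! ### From faithful flatness of C to strictness -/

section CoringFlat

variable (A C : Type u) [Ring A] [AddCommGroup C] [Module A C] [Module Aᵐᵒᵖ C]
    [SMulCommClass A Aᵐᵒᵖ C] [Coring A C]

/-- The coordinate functionals of a dual basis of C generate C* as a left A-module: g = Σ g(x_k)
f_k. -/
lemma finite_rightDual (h : FGProjective Aᵐᵒᵖ C) : Module.Finite A (RightDual A C) := by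
  obtain ⟨n, f, x, h⟩ := h.exists_dual_basis
  let p : (Fin n → A) →ₗ[A] RightDual A C :=
    ∑ k, (LinearMap.toSpanSingleton A (RightDual A C) ((opEquiv A).symm.toLinearMap ∘ₗ f k)) ∘ₗ
      LinearMap.proj k
  refine Module.Finite.of_surjective p fun g => ⟨fun k => g.lin (x k), RightDual.ext fun c => ?_⟩
  conv_rhs => rw [← h c, map_sum]
  simp only [p, LinearMap.sum_apply, sum_lin_right, map_smul]
  rfl

lemma finite_leftDual (h : FGProjective A C) : Module.Finite Aᵐᵒᵖ (LeftDual A C)ᵐᵒᵖ := by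
  obtain ⟨n, f, x, h⟩ := h.exists_dual_basis
  let p : (Fin n → Aᵐᵒᵖ) →ₗ[Aᵐᵒᵖ] (LeftDual A C)ᵐᵒᵖ :=
    ∑ k, (LinearMap.toSpanSingleton Aᵐᵒᵖ (LeftDual A C)ᵐᵒᵖ (op (f k : LeftDual A C))) ∘ₗ
      LinearMap.proj k
  refine Module.Finite.of_surjective p fun g => ⟨fun k => op (g.unop.lin (x k)),
    unop_injective (LeftDual.ext fun c => ?_)⟩
  conv_rhs => rw [← h c, map_sum]
  simp only [p, LinearMap.sum_apply, Finset.unop_sum, sum_lin_left, map_smul]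
  rfl

variable {A C}

/-- Flatness produces surjectivity of τ, through projectivity over C*; faithfulness then produces
surjectivity of μ. -/
lemma strict_of_faithfullyFlatLeft (hl : FGProjective A C) (hr : FGProjective Aᵐᵒᵖ C)
    (h : FaithfullyFlatLeft (RightDual A C) C) : (coringContext A C).Strict := by
  have := hl.finitePresentation (finite_rightDual A C hr)
  have hτ := τ_surjective_of_left (rightDual_separates hr.weaklyLocallyProjective)
    (fgProjective_iff_isSummandOfPower.1 h.fgProjective)
  exact ⟨MoritaContext.μ_surjective_of_faithfullyFlatLeft h hτ, hτ⟩

lemma strict_of_faithfullyFlatRight (hl : FGProjective A C) (hr : FGProjective Aᵐᵒᵖ C)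
    (h : FaithfullyFlatRight (LeftDual A C) C) : (coringContext A C).Strict := by
  have := hr.finitePresentation (finite_leftDual A C hl)
  have hμ := μ_surjective_of_right (leftDual_separates hl.weaklyLocallyProjective)
    ((fgProjective_iff_isSummandOfPower.1 h.fgProjective).of_equiv (opEquiv _).symm)
  exact ⟨hμ, MoritaContext.τ_surjective_of_faithfullyFlatRight h hμ⟩

end CoringFlat

/-! ### Functionals separate elements of a tensor product -/

section Contractions

variable {R M N M' N' : Type u} [Ring R] [AddCommGroup M] [AddCommGroup N] [Module Rᵐᵒᵖ M]
  [Module R N] [AddCommGroup M'] [AddCommGroup N'] [Module Rᵐᵒᵖ M'] [Module R N']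

lemma BT.rsmul_map (f : N →ₗ[R] R) (φ : M →ₗ[Rᵐᵒᵖ] M') (t : BT R M N) :
    BT.rsmul f (BT.map φ LinearMap.id t) = φ (BT.rsmul f t) := by
  induction t using BT.induction with
  | h0 => simp
  | ht m n => exact (φ.map_smul _ _).symm
  | ha x y hx hy => simp only [map_add, hx, hy]

lemma BT.lsmul_map (f : M →ₗ[Rᵐᵒᵖ] R) (φ : N →ₗ[R] N') (t : BT R M N) :
    BT.lsmul f (BT.map LinearMap.id φ t) = φ (BT.lsmul f t) := by
  induction t using BT.induction with
  | h0 => simp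
  | ht m n => exact (φ.map_smul _ _).symm
  | ha x y hx hy => simp only [map_add, hx, hy]

/-- A dual basis of N reconstructs every t as the sum of its contractions tensored with the basis
elements. Identities in M ⊗ C, such as colinearity and coassociativity, can thus be tested by
functionals. -/
lemma BT.eq_of_rsmul_eq (h : FGProjective R N) {s t : BT R M N}
    (hst : ∀ f : N →ₗ[R] R, BT.rsmul f s = BT.rsmul f t) : s = t := by
  obtain ⟨n, f, x, h⟩ := h.exists_dual_basis
  have key : ∀ t : BT R M N, ∑ k, BT.tmul R (BT.rsmul (f k) t) (x k) = t := fun t => by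
    induction t using BT.induction with
    | h0 => simp [BT.zero_tmul]
    | ht m c =>
      conv_rhs => rw [← h c]
      refine Eq.trans ?_ (map_sum (AddMonoidHom.mk' (BT.tmul R m) (BT.tmul_add m)) _ _).symm
      exact Finset.sum_congr rfl fun k _ => BT.smul_tmul _ _ _
    | ha x y hx hy => simp only [map_add, BT.add_tmul, Finset.sum_add_distrib, hx, hy]
  rw [← key s, ← key t]
  simp only [hst]

lemma FGProjective.exists_dual_basis_op (h : FGProjective Rᵐᵒᵖ M) :
    ∃ (n : ℕ) (f : Fin n → M →ₗ[Rᵐᵒᵖ] R) (x : Fin n → M), ∀ m, ∑ k, op (f k m) • x k = m := by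
  obtain ⟨n, f, x, h⟩ := h.exists_dual_basis
  exact ⟨n, fun k => (opEquiv R).symm.toLinearMap ∘ₗ f k, x, h⟩

lemma BT.eq_of_lsmul_eq (h : FGProjective Rᵐᵒᵖ M) {s t : BT R M N}
    (hst : ∀ f : M →ₗ[Rᵐᵒᵖ] R, BT.lsmul f s = BT.lsmul f t) : s = t := by
  obtain ⟨n, f, x, h⟩ := h.exists_dual_basis_op
  have key : ∀ t : BT R M N, ∑ k, BT.tmul R (x k) (BT.lsmul (f k) t) = t := fun t => by
    induction t using BT.induction with
    | h0 => simp [BT.tmul_zero]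
    | ht c m =>
      conv_rhs => rw [← h c]
      refine Eq.trans ?_ (map_sum (AddMonoidHom.mk' (fun c => BT.tmul R c m)
        (fun c c' => BT.add_tmul c c' m)) _ _).symm
      exact Finset.sum_congr rfl fun k _ => (BT.smul_tmul _ _ _).symm
    | ha x y hx hy => simp only [map_add, BT.tmul_add, Finset.sum_add_distrib, hx, hy]
  rw [← key s, ← key t]
  simp only [hst]

end Contractions

/-! ### Comodules as modules over the dual rings -/

section ComodulesAsModules

variable {A C : Type u} [Ring A] [AddCommGroup C] [Module A C] [Module Aᵐᵒᵖ C]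
    [SMulCommClass A Aᵐᵒᵖ C] [Coring A C]

lemma rsmul_add_apply {M : Type u} [AddCommGroup M] [Module Aᵐᵒᵖ M] (f g : LeftDual A C)
    (t : BT A M C) : BT.rsmul (f + g).lin t = BT.rsmul f.lin t + BT.rsmul g.lin t := by
  induction t using BT.induction with
  | h0 => simp
  | ht x y => simp [add_smul]
  | ha x y hx hy => simp only [map_add, hx, hy]; abel

lemma lsmul_add_apply {M : Type u} [AddCommGroup M] [Module A M] (f g : RightDual A C)
    (t : BT A C M) : BT.lsmul (f + g).lin t = BT.lsmul f.lin t + BT.lsmul g.lin t := by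
  induction t using BT.induction with
  | h0 => simp
  | ht x y => simp [add_smul]
  | ha x y hx hy => simp only [map_add, hx, hy]; abel

lemma rsmul_zero_apply {M : Type u} [AddCommGroup M] [Module Aᵐᵒᵖ M]
    (t : BT A M C) : BT.rsmul (0 : LeftDual A C).lin t = 0 := by
  have h := rsmul_add_apply (0 : LeftDual A C) 0 t
  rwa [add_zero, left_eq_add] at h

lemma lsmul_zero_apply {M : Type u} [AddCommGroup M] [Module A M]
    (t : BT A C M) : BT.lsmul (0 : RightDual A C).lin t = 0 := by
  have h := lsmul_add_apply (0 : RightDual A C) 0 t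
  rwa [add_zero, left_eq_add] at h

/-- The product of *C is designed so that contracting the last two factors of (M ⊗ C) ⊗ C one after
the other is contraction by a product. With coassociativity this makes the contracted coaction an
associative action. -/
lemma rsmul_mul {M : Type u} [AddCommGroup M] [Module Aᵐᵒᵖ M] (f g : LeftDual A C)
    (t : BT A M C) : BT.rsmul (g * f).lin t = BT.rsmul f.lin (BT.rsmul g.lin
      (BT.assocInv (BT.map (LinearMap.id (R := Aᵐᵒᵖ)) (Coring.comulL A C) t))) := by
  induction t using BT.induction with
  | h0 => simp
  | ht m c =>
    change op (f.lin (BT.rsmul g.lin (Coring.comulL A C c))) • m = BT.rsmul f.lin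
      (BT.rsmul g.lin (BT.assocInv (BT.tmul A m (Coring.comulL A C c))))
    induction Coring.comulL A C c using BT.induction with
    | h0 => simp [BT.tmul_zero]
    | ht u v => rfl
    | ha u v hu hv => simp only [map_add, MulOpposite.op_add, add_smul, BT.tmul_add, hu, hv]
  | ha x y hx hy => simp only [map_add, hx, hy]

lemma lsmul_mul {M : Type u} [AddCommGroup M] [Module A M] (f g : RightDual A C)
    (t : BT A C M) : BT.lsmul (f * g).lin t = BT.lsmul f.lin (BT.lsmul g.lin
      (BT.assoc (BT.map (Coring.comulR A C) (LinearMap.id (R := A)) t))) := by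
  induction t using BT.induction with
  | h0 => simp
  | ht c m =>
    change f.lin (BT.lsmul g.lin (Coring.comulR A C c)) • m = BT.lsmul f.lin
      (BT.lsmul g.lin (BT.assoc (BT.tmul A (Coring.comulR A C c) m)))
    induction Coring.comulR A C c using BT.induction with
    | h0 => simp [BT.zero_tmul]
    | ht u v => rfl
    | ha u v hu hv => simp only [map_add, add_smul, BT.add_tmul, hu, hv]
  | ha x y hx hy => simp only [map_add, hx, hy]

lemma op_smul_rsmul {M : Type u} [AddCommGroup M] [Module Aᵐᵒᵖ M] (a : Aᵐᵒᵖ) (f : LeftDual A C)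
    (t : BT A M C) : BT.rsmul (a • f).lin t = a • BT.rsmul f.lin t := by
  induction t using BT.induction with
  | h0 => simp
  | ht x y => exact mul_smul a (op (f.lin y)) x
  | ha x y hx hy => rw [map_add, map_add, hx, hy, smul_add]

lemma smul_lsmul {M : Type u} [AddCommGroup M] [Module A M] (a : A) (f : RightDual A C)
    (t : BT A C M) : BT.lsmul (a • f).lin t = a • BT.lsmul f.lin t := by
  induction t using BT.induction with
  | h0 => simp
  | ht x y => exact mul_smul a (f.lin x) y
  | ha x y hx hy => rw [map_add, map_add, hx, hy, smul_add]

/-- Right multiplication by a on C is the action of the element a • 1 of *C, so it can be absorbed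
into the functional. -/
lemma rsmul_op_smul {M : Type u} [AddCommGroup M] [Module Aᵐᵒᵖ M] (a : Aᵐᵒᵖ) (f : LeftDual A C)
    (t : BT A M C) : BT.rsmul f.lin (a • t) = BT.rsmul ((a • (1 : LeftDual A C)) * f).lin t := by
  induction t using BT.induction with
  | h0 => simp
  | ht m c =>
    change op (f.lin (a • c)) • m = op (f.lin ((a • op (1 : LeftDual A C)) • c)) • m
    rw [smul_assoc, op_one, one_smul]
  | ha x y hx hy => rw [smul_add, map_add, map_add, hx, hy]

lemma lsmul_smul {M : Type u} [AddCommGroup M] [Module A M] (a : A) (f : RightDual A C)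
    (t : BT A C M) : BT.lsmul f.lin (a • t) = BT.lsmul (f * (a • (1 : RightDual A C))).lin t := by
  induction t using BT.induction with
  | h0 => simp
  | ht c m =>
    change f.lin (a • c) • m = f.lin ((a • (1 : RightDual A C)) • c) • m
    rw [smul_assoc, one_smul]
  | ha x y hx hy => rw [smul_add, map_add, map_add, hx, hy]

lemma eq_of_rsmul_lin_eq (h : FGProjective A C) {M : Type u} [AddCommGroup M] [Module Aᵐᵒᵖ M]
    {s t : BT A M C} (hst : ∀ f : LeftDual A C, BT.rsmul f.lin s = BT.rsmul f.lin t) : s = t :=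
  BT.eq_of_rsmul_eq h hst

lemma eq_of_lsmul_lin_eq (h : FGProjective Aᵐᵒᵖ C) {M : Type u} [AddCommGroup M] [Module A M]
    {s t : BT A C M} (hst : ∀ f : RightDual A C, BT.lsmul f.lin s = BT.lsmul f.lin t) : s = t :=
  BT.eq_of_lsmul_eq h hst

/-- The *C-action induced by the coaction on N ⊗_{C*} C is the one inherited from the factor C. This
identifies `rightTensor` with the bimodule tensor functor. -/
lemma rsmul_coactR {N : Type u} [AddCommGroup N] [Module (RightDual A C)ᵐᵒᵖ N]
    (f : LeftDual A C) (t : BT (RightDual A C) N C) :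
    BT.rsmul f.lin (coactR A C N t) = op f • t := by
  induction t using BT.induction with
  | h0 => simp
  | ht n c => rw [coactR_tmul, BT.rsmul_map]; rfl
  | ha x y hx hy => rw [map_add, map_add, hx, hy, smul_add]

lemma lsmul_coactL {N : Type u} [AddCommGroup N] [Module (LeftDual A C) N]
    (f : RightDual A C) (t : BT (LeftDual A C) C N) :
    BT.lsmul f.lin (coactL A C N t) = f • t := by
  induction t using BT.induction with
  | h0 => simp
  | ht c n => rw [coactL_tmul, BT.lsmul_map]; rfl
  | ha x y hx hy => rw [map_add, map_add, hx, hy, smul_add]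

/-- A right `C`-comodule is a right `*C`-module by `m · f = m₀ f(m₁)`. -/
instance RComod.dualModule (M : RComod A C) : Module (LeftDual A C)ᵐᵒᵖ M.carrier where
  smul f m := BT.rsmul f.unop.lin (M.coact m)
  one_smul := M.counit
  mul_smul f g m := by
    change BT.rsmul (g.unop * f.unop).lin (M.coact m) =
      BT.rsmul f.unop.lin (M.coact (BT.rsmul g.unop.lin (M.coact m)))
    rw [rsmul_mul, ← M.coassoc, BT.rsmul_map]
  smul_zero f := by
    change BT.rsmul f.unop.lin (M.coact 0) = 0
    rw [map_zero, map_zero]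
  smul_add f m m' := by
    change BT.rsmul f.unop.lin (M.coact (m + m')) = _
    rw [map_add, map_add]
    rfl
  add_smul f g m := rsmul_add_apply f.unop g.unop (M.coact m)
  zero_smul m := rsmul_zero_apply (M.coact m)

/-- A left `C`-comodule is a left `C*`-module by `f · m = f(m₋₁) m₀`. -/
instance LComod.dualModule (M : LComod A C) : Module (RightDual A C) M.carrier where
  smul f m := BT.lsmul f.lin (M.coact m)
  one_smul := M.counit
  mul_smul f g m := by
    change BT.lsmul (f * g).lin (M.coact m) =
      BT.lsmul f.lin (M.coact (BT.lsmul g.lin (M.coact m)))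
    rw [lsmul_mul, ← M.coassoc, BT.lsmul_map]
  smul_zero f := by
    change BT.lsmul f.lin (M.coact 0) = 0
    rw [map_zero, map_zero]
  smul_add f m m' := by
    change BT.lsmul f.lin (M.coact (m + m')) = _
    rw [map_add, map_add]
    rfl
  add_smul f g m := lsmul_add_apply f g (M.coact m)
  zero_smul m := lsmul_zero_apply (M.coact m)

instance (M : RComod A C) : IsScalarTower Aᵐᵒᵖ (LeftDual A C)ᵐᵒᵖ M.carrier where
  smul_assoc a f m := op_smul_rsmul a f.unop (M.coact m)

instance (M : LComod A C) : IsScalarTower A (RightDual A C) M.carrier where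
  smul_assoc a f m := smul_lsmul a f (M.coact m)

variable (A C) in
/-- The functor from right `C`-comodules to right `*C`-modules. -/
def rComodToModule : RComod A C ⥤ ModuleCat.{u} (LeftDual A C)ᵐᵒᵖ where
  obj M := ModuleCat.of _ M.carrier
  map {M N} f := ModuleCat.ofHom
    { f.lin with
      map_smul' := fun g m => by
        change f.lin (BT.rsmul g.unop.lin (M.coact m)) = BT.rsmul g.unop.lin (N.coact (f.lin m))
        rw [f.comm, BT.rsmul_map] }
  map_id _ := rfl
  map_comp _ _ := rfl

variable (A C) in
/-- The functor from left `C`-comodules to left `C*`-modules. -/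
def lComodToModule : LComod A C ⥤ ModuleCat.{u} (RightDual A C) where
  obj M := ModuleCat.of _ M.carrier
  map {M N} f := ModuleCat.ofHom
    { f.lin with
      map_smul' := fun g m => by
        change f.lin (BT.lsmul g.lin (M.coact m)) = BT.lsmul g.lin (N.coact (f.lin m))
        rw [f.comm, BT.lsmul_map] }
  map_id _ := rfl
  map_comp _ _ := rfl

instance : (rComodToModule A C).Faithful where
  map_injective h := RComod.Hom.ext (LinearMap.ext fun m =>
    LinearMap.congr_fun (congrArg ModuleCat.Hom.hom h) m)

instance : (lComodToModule A C).Faithful where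
  map_injective h := LComod.Hom.ext (LinearMap.ext fun m =>
    LinearMap.congr_fun (congrArg ModuleCat.Hom.hom h) m)

/-- Contracted with f, the condition of colinearity is linearity with respect to f, and such
contractions determine elements of N ⊗ C. -/
lemma full_rComodToModule (h : FGProjective A C) : (rComodToModule A C).Full where
  map_surjective {M N} φ := by
    let φ' : M.carrier →ₗ[(LeftDual A C)ᵐᵒᵖ] N.carrier := φ.hom
    refine ⟨⟨φ'.restrictScalars Aᵐᵒᵖ, fun m => eq_of_rsmul_lin_eq h fun f => ?_⟩, rfl⟩
    rw [BT.rsmul_map]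
    exact (φ'.map_smul (op f) m).symm

lemma full_lComodToModule (h : FGProjective Aᵐᵒᵖ C) : (lComodToModule A C).Full where
  map_surjective {M N} φ := by
    let φ' : M.carrier →ₗ[RightDual A C] N.carrier := φ.hom
    refine ⟨⟨φ'.restrictScalars A, fun m => eq_of_lsmul_lin_eq h fun f => ?_⟩, rfl⟩
    rw [BT.lsmul_map]
    exact (φ'.map_smul f m).symm

/-- The coaction is n ↦ Σ n · g_k ⊗ x_k for a dual basis of C over A; it recovers the action because
f = Σ g_k f(x_k) in *C. -/
lemma exists_coaction_right (h : FGProjective A C) (N : Type u) [AddCommGroup N]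
    [Module (LeftDual A C)ᵐᵒᵖ N] [Module Aᵐᵒᵖ N] [IsScalarTower Aᵐᵒᵖ (LeftDual A C)ᵐᵒᵖ N] :
    ∃ ρ : N →ₗ[Aᵐᵒᵖ] BT A N C, ∀ (f : LeftDual A C) n, BT.rsmul f.lin (ρ n) = op f • n := by
  obtain ⟨m, g, x, hg⟩ := h.exists_dual_basis
  let g' : Fin m → LeftDual A C := g
  let ρ : N →+ BT A N C := AddMonoidHom.mk' (fun n => ∑ k, BT.tmul A (op (g' k) • n) (x k))
    (fun n n' => by simp only [smul_add, BT.add_tmul, Finset.sum_add_distrib])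
  have hρ : ∀ (f : LeftDual A C) n, BT.rsmul f.lin (ρ n) = op f • n := fun f n => by
    have hf : ∑ k, op (f.lin (x k)) • g' k = f := LeftDual.ext fun c => by
      conv_rhs => rw [← hg c, map_sum]
      simp only [sum_lin_left, LeftDual.op_smul_lin, map_smul]
      rfl
    change BT.rsmul f.lin (∑ k, BT.tmul A (op (g' k) • n) (x k)) = _
    conv_rhs => rw [← hf, Finset.op_sum, Finset.sum_smul]
    rw [map_sum]
    exact Finset.sum_congr rfl fun k _ => (smul_assoc (op (f.lin (x k))) (op (g' k)) n).symm
  refine ⟨{ ρ with map_smul' := fun a n => eq_of_rsmul_lin_eq h fun f => ?_ }, hρ⟩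
  change BT.rsmul f.lin (ρ (a • n)) = BT.rsmul f.lin (a • ρ n)
  rw [rsmul_op_smul, hρ, hρ, op_mul, mul_smul, op_smul, smul_assoc a, op_one, one_smul]

lemma exists_coaction_left (h : FGProjective Aᵐᵒᵖ C) (N : Type u) [AddCommGroup N]
    [Module (RightDual A C) N] [Module A N] [IsScalarTower A (RightDual A C) N] :
    ∃ ρ : N →ₗ[A] BT A C N, ∀ (f : RightDual A C) n, BT.lsmul f.lin (ρ n) = f • n := by
  obtain ⟨m, g, x, hg⟩ := h.exists_dual_basis_op
  let g' : Fin m → RightDual A C := g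
  let ρ : N →+ BT A C N := AddMonoidHom.mk' (fun n => ∑ k, BT.tmul A (x k) (g' k • n))
    (fun n n' => by simp only [smul_add, BT.tmul_add, Finset.sum_add_distrib])
  have hρ : ∀ (f : RightDual A C) n, BT.lsmul f.lin (ρ n) = f • n := fun f n => by
    have hf : ∑ k, f.lin (x k) • g' k = f := RightDual.ext fun c => by
      conv_rhs => rw [← hg c, map_sum]
      simp only [sum_lin_right, RightDual.smul_lin, map_smul]
      rfl
    change BT.lsmul f.lin (∑ k, BT.tmul A (x k) (g' k • n)) = _
    conv_rhs => rw [← hf, Finset.sum_smul]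
    rw [map_sum]
    exact Finset.sum_congr rfl fun k _ => (smul_assoc (f.lin (x k)) (g' k) n).symm
  refine ⟨{ ρ with map_smul' := fun a n => eq_of_lsmul_lin_eq h fun f => ?_ }, hρ⟩
  change BT.lsmul f.lin (ρ (a • n)) = BT.lsmul f.lin (a • ρ n)
  rw [lsmul_smul, hρ, hρ, mul_smul, smul_assoc a, one_smul]

lemma essSurj_rComodToModule (h : FGProjective A C) : (rComodToModule A C).EssSurj where
  mem_essImage N := by
    -- A *C-module has no A-structure in advance; it is pulled back along the ring map Aᵐᵒᵖ → *Cᵐᵒᵖ,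
    -- a ↦ a • 1.
    let : Module Aᵐᵒᵖ N :=
      Module.compHom N (RingHom.smulOneHom (R := Aᵐᵒᵖ) (S := (LeftDual A C)ᵐᵒᵖ))
    have : IsScalarTower Aᵐᵒᵖ (LeftDual A C)ᵐᵒᵖ N :=
      ⟨fun a f n => by
        change (a • f) • n = (a • (1 : (LeftDual A C)ᵐᵒᵖ)) • f • n
        rw [← mul_smul, smul_mul_assoc, one_mul]⟩
    obtain ⟨ρ, hρ⟩ := exists_coaction_right h N
    let M : RComod A C :=
      { carrier := N
        coact := ρ
        -- Contracting both factors C reduces coassociativity to associativity of the action on N.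
        coassoc := fun n => eq_of_rsmul_lin_eq h fun f => eq_of_rsmul_lin_eq h fun g => by
          rw [BT.rsmul_map]
          refine Eq.trans ?_ (rsmul_mul g f (ρ n))
          rw [hρ, hρ, hρ, op_mul, mul_smul]
        counit := fun n => (hρ 1 n).trans (one_smul _ n) }
    let e : (rComodToModule A C).obj M ≃ₗ[(LeftDual A C)ᵐᵒᵖ] N :=
      { toFun := fun n => n
        invFun := fun n => n
        map_add' := fun _ _ => rfl
        map_smul' := fun f n => hρ f.unop n
        left_inv := fun _ => rfl
        right_inv := fun _ => rfl }
    exact ⟨M, ⟨e.toModuleIso⟩⟩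

lemma essSurj_lComodToModule (h : FGProjective Aᵐᵒᵖ C) : (lComodToModule A C).EssSurj where
  mem_essImage N := by
    let : Module A N := Module.compHom N (RingHom.smulOneHom (R := A) (S := RightDual A C))
    have : IsScalarTower A (RightDual A C) N :=
      ⟨fun a f n => by
        change (a • f) • n = (a • (1 : RightDual A C)) • f • n
        rw [← mul_smul, smul_mul_assoc, one_mul]⟩
    obtain ⟨ρ, hρ⟩ := exists_coaction_left h N
    let M : LComod A C :=
      { carrier := N
        coact := ρ
        coassoc := fun n => eq_of_lsmul_lin_eq h fun f => eq_of_lsmul_lin_eq h fun g => by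
          rw [BT.lsmul_map]
          refine Eq.trans ?_ (lsmul_mul g f (ρ n))
          rw [hρ, hρ, hρ, mul_smul]
        counit := fun n => (hρ 1 n).trans (one_smul _ n) }
    let e : (lComodToModule A C).obj M ≃ₗ[RightDual A C] N :=
      { toFun := fun n => n
        invFun := fun n => n
        map_add' := fun _ _ => rfl
        map_smul' := fun f n => hρ f n
        left_inv := fun _ => rfl
        right_inv := fun _ => rfl }
    exact ⟨M, ⟨e.toModuleIso⟩⟩

lemma isEquivalence_rComodToModule (h : FGProjective A C) :
    (rComodToModule A C).IsEquivalence where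
  full := full_rComodToModule h
  essSurj := essSurj_rComodToModule h

lemma isEquivalence_lComodToModule (h : FGProjective Aᵐᵒᵖ C) :
    (lComodToModule A C).IsEquivalence where
  full := full_lComodToModule h
  essSurj := essSurj_lComodToModule h

variable (A C) in
/-- Viewed with values in right `*C`-modules, `- ⊗_{C*} C` is the tensor functor of the bimodule
`C`. -/
def rightTensorCompIso : rightTensor A C ⋙ rComodToModule A C ≅
    bimoduleTensor (RightDual A C) (LeftDual A C) C :=
  NatIso.ofComponents (fun N => LinearEquiv.toModuleIso
    { AddEquiv.refl (BT (RightDual A C) N C) with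
      map_smul' := fun f t => rsmul_coactR f.unop t })
    (fun _ => rfl)

variable (A C) in
/-- Viewed with values in left `C*`-modules, `C ⊗_{*C} -` is the tensor functor of the bimodule
`C`. -/
def leftTensorCompIso : leftTensor A C ⋙ lComodToModule A C ≅
    bimoduleTensorLeft (RightDual A C) (LeftDual A C) C :=
  NatIso.ofComponents (fun N => LinearEquiv.toModuleIso
    { AddEquiv.refl (BT (LeftDual A C) C N) with
      map_smul' := fun f t => lsmul_coactL f t })
    (fun _ => rfl)

/-- The two functors differ by the equivalence of comodules with *C-modules. -/
lemma rightTensor_isEquivalence_iff (h : FGProjective A C) : (rightTensor A C).IsEquivalence ↔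
    (bimoduleTensor (RightDual A C) (LeftDual A C) C).IsEquivalence := by
  have := isEquivalence_rComodToModule h
  constructor
  · intro _
    exact Functor.isEquivalence_of_iso (rightTensorCompIso A C)
  · intro _
    have := Functor.isEquivalence_of_iso (rightTensorCompIso A C).symm
    exact Functor.isEquivalence_of_comp_right (rightTensor A C) (rComodToModule A C)

lemma leftTensor_isEquivalence_iff (h : FGProjective Aᵐᵒᵖ C) : (leftTensor A C).IsEquivalence ↔
    (bimoduleTensorLeft (RightDual A C) (LeftDual A C) C).IsEquivalence := by
  have := isEquivalence_lComodToModule h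
  constructor
  · intro _
    exact Functor.isEquivalence_of_iso (leftTensorCompIso A C)
  · intro _
    have := Functor.isEquivalence_of_iso (leftTensorCompIso A C).symm
    exact Functor.isEquivalence_of_comp_right (leftTensor A C) (lComodToModule A C)

lemma isProgenerator_functor_obj_iff {𝒞 𝒟 : Type (u + 1)} [Category.{u} 𝒞] [Category.{u} 𝒟]
    (F : 𝒞 ⥤ 𝒟) [F.IsEquivalence] (X : 𝒞) : IsProgenerator (F.obj X) ↔ IsProgenerator X :=
  ⟨fun h => isProgenerator_of_iso (F.asEquivalence.unitIso.app X).symm (h.map F.asEquivalence.symm),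
    fun h => h.map F.asEquivalence⟩

/-- Under that equivalence the comodule C becomes the right *C-module C, where being a progenerator
means similarity to the ring. -/
lemma isProgenerator_rComod_self_iff (h : FGProjective A C) :
    IsProgenerator (RComod.self A C) ↔ Similar (LeftDual A C)ᵐᵒᵖ C (LeftDual A C) := by
  have := isEquivalence_rComodToModule h
  rw [← isProgenerator_functor_obj_iff (rComodToModule A C)]
  refine (isProgenerator_iff_similar (LeftDual A C)ᵐᵒᵖ C).trans
    ⟨fun h => h.of_equiv (opEquiv _).symm, fun h => h.of_equiv (opEquiv _)⟩

lemma isProgenerator_lComod_self_iff (h : FGProjective Aᵐᵒᵖ C) :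
    IsProgenerator (LComod.self A C) ↔ Similar (RightDual A C) C (RightDual A C) := by
  have := isEquivalence_lComodToModule h
  rw [← isProgenerator_functor_obj_iff (lComodToModule A C)]
  exact isProgenerator_iff_similar (RightDual A C) C

end ComodulesAsModules

/-! ### Equivalences preserve and reflect exactness -/

section Equivalences

lemma exact_map_iff_of_isEquivalence {R S : Type u} [Ring R] [Ring S]
    (F : ModuleCat.{u} R ⥤ ModuleCat.{u} S) [F.IsEquivalence] {X Y Z : ModuleCat.{u} R}
    (f : X ⟶ Y) (g : Y ⟶ Z) :
    Function.Exact f.hom g.hom ↔ Function.Exact (F.map f).hom (F.map g).hom := by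
  have : F.PreservesZeroMorphisms := F.preservesZeroMorphisms_of_full
  -- The categorical criterion needs a complex. If the composite is nonzero, neither sequence is
  -- exact, because an equivalence is faithful.
  by_cases w : f ≫ g = 0
  · let T := ShortComplex.mk f g w
    have h1 := (ShortComplex.ShortExact.moduleCat_exact_iff_function_exact T).symm
    have h2 := ShortComplex.ShortExact.moduleCat_exact_iff_function_exact (T.map F)
    exact (h1.trans (T.exact_map_iff_of_faithful F).symm).trans h2
  · refine iff_of_false (fun h => w ?_) (fun h => w ?_)
    · exact ModuleCat.hom_ext (LinearMap.ext fun x => h.apply_apply_eq_zero x)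
    · refine F.map_injective ?_
      rw [F.map_comp, F.map_zero]
      exact ModuleCat.hom_ext (LinearMap.ext fun x => h.apply_apply_eq_zero x)

variable (R S P : Type u) [Ring R] [Ring S] [AddCommGroup P] [Module R P] [Module Sᵐᵒᵖ P]
  [SMulCommClass R Sᵐᵒᵖ P]

lemma faithfullyFlatLeft_of_isEquivalence (h : (bimoduleTensor R S P).IsEquivalence) :
    FaithfullyFlatLeft R P := fun _ _ _ _ _ _ _ _ _ f g =>
  exact_map_iff_of_isEquivalence (bimoduleTensor R S P) (ModuleCat.ofHom f) (ModuleCat.ofHom g)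

lemma faithfullyFlatRight_of_isEquivalence (h : (bimoduleTensorLeft R S P).IsEquivalence) :
    FaithfullyFlatRight S P := fun _ _ _ _ _ _ _ _ _ f g =>
  exact_map_iff_of_isEquivalence (bimoduleTensorLeft R S P) (ModuleCat.ofHom f)
    (ModuleCat.ofHom g)

end Equivalences

/-! ### From the quasi-Frobenius and similarity conditions to strictness -/

section QuasiFrobeniusStrict

variable {A C : Type u} [Ring A] [AddCommGroup C] [Module A C] [Module Aᵐᵒᵖ C]
    [SMulCommClass A Aᵐᵒᵖ C] [Coring A C]

lemma strict_of_quasiFrobenius (hr : IsSummandOfPower (LeftDual A C)ᵐᵒᵖ C (LeftDual A C))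
    (hl : IsSummandOfPower (RightDual A C) C (RightDual A C)) :
    (FGProjective A C ∧ FGProjective Aᵐᵒᵖ C) ∧ (coringContext A C).Strict := by
  have h1 := fgProjective_of_isSummandOfPower hl
  have h2 := fgProjective_op_of_isSummandOfPower hr
  exact ⟨⟨h1, h2⟩, μ_surjective_of_right (leftDual_separates h1.weaklyLocallyProjective) hr,
    τ_surjective_of_left (rightDual_separates h2.weaklyLocallyProjective) hl⟩

/-- Both equations are first read over C*, where only C* needs to separate points. Strictness then
yields the summand property over *C, and with it projectivity over A on the right. -/
lemma strict_of_similar_rightDual (h : WeaklyLocallyProjective Aᵐᵒᵖ C)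
    (hs : Similar (RightDual A C) C (RightDual A C)) :
    (FGProjective A C ∧ FGProjective Aᵐᵒᵖ C) ∧ (coringContext A C).Strict := by
  have hμ := μ_surjective_of_left (rightDual_separates h) hs.2
  have hτ := τ_surjective_of_left (rightDual_separates h) hs.1
  exact strict_of_quasiFrobenius (similar_of_strict A C ⟨hμ, hτ⟩).2.1 hs.1

lemma strict_of_similar_leftDual (h : WeaklyLocallyProjective A C)
    (hs : Similar (LeftDual A C)ᵐᵒᵖ C (LeftDual A C)) :
    (FGProjective A C ∧ FGProjective Aᵐᵒᵖ C) ∧ (coringContext A C).Strict := by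
  have hμ := μ_surjective_of_right (leftDual_separates h) hs.1
  have hτ := τ_surjective_of_right (leftDual_separates h) hs.2
  exact strict_of_quasiFrobenius hs.1 (similar_of_strict A C ⟨hμ, hτ⟩).1.1

end QuasiFrobeniusStrict

end CoringTheory

end

open CoringTheory in
theorem corollary4p8 (A C : Type u) [Ring A] [AddCommGroup C] [Module A C] [Module Aᵐᵒᵖ C]
    [SMulCommClass A Aᵐᵒᵖ C] [Coring A C] :
    List.TFAE [
      -- `C` is left and right quasi-Frobenius
      IsSummandOfPower (LeftDual A C)ᵐᵒᵖ C (LeftDual A C) ∧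
        IsSummandOfPower (RightDual A C) C (RightDual A C),
      WeaklyLocallyProjective Aᵐᵒᵖ C ∧ Similar (RightDual A C) C (RightDual A C),
      WeaklyLocallyProjective A C ∧ Similar (LeftDual A C)ᵐᵒᵖ C (LeftDual A C),
      FGProjective A C ∧ IsProgenerator (RComod.self A C),
      FGProjective Aᵐᵒᵖ C ∧ IsProgenerator (LComod.self A C),
      (FGProjective A C ∧ FGProjective Aᵐᵒᵖ C) ∧ (coringContext A C).Strict,
      (FGProjective A C ∧ FGProjective Aᵐᵒᵖ C) ∧ (rightTensor A C).IsEquivalence,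
      (FGProjective A C ∧ FGProjective Aᵐᵒᵖ C) ∧ FaithfullyFlatLeft (RightDual A C) C,
      (FGProjective A C ∧ FGProjective Aᵐᵒᵖ C) ∧ (leftTensor A C).IsEquivalence,
      (FGProjective A C ∧ FGProjective Aᵐᵒᵖ C) ∧ FaithfullyFlatRight (LeftDual A C) C] ∧
    ((FGProjective A C ∧ FGProjective Aᵐᵒᵖ C) ∧ (coringContext A C).Strict →
      (bimoduleTensor (RightDual A C) (LeftDual A C) C).IsEquivalence) := by
  refine ⟨?_, fun h => h.2.isEquivalence_bimoduleTensor⟩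
  -- Item 6, strictness with C finitely generated projective over A on both sides, is the hub: it
  -- implies each of the others, in two cases through the preceding item, and each leads back to it.
  tfae_have 1 → 6 := fun h => strict_of_quasiFrobenius h.1 h.2
  tfae_have 6 → 1 := fun h =>
    ⟨(similar_of_strict A C h.2).2.1, (similar_of_strict A C h.2).1.1⟩
  tfae_have 2 → 6 := fun h => strict_of_similar_rightDual h.1 h.2
  tfae_have 6 → 2 := fun h => ⟨h.1.2.weaklyLocallyProjective, (similar_of_strict A C h.2).1⟩
  tfae_have 3 → 6 := fun h => strict_of_similar_leftDual h.1 h.2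
  tfae_have 6 → 3 := fun h => ⟨h.1.1.weaklyLocallyProjective, (similar_of_strict A C h.2).2⟩
  tfae_have 4 → 3 := fun h =>
    ⟨h.1.weaklyLocallyProjective, (isProgenerator_rComod_self_iff h.1).1 h.2⟩
  tfae_have 6 → 4 := fun h =>
    ⟨h.1.1, (isProgenerator_rComod_self_iff h.1.1).2 (similar_of_strict A C h.2).2⟩
  tfae_have 5 → 2 := fun h =>
    ⟨h.1.weaklyLocallyProjective, (isProgenerator_lComod_self_iff h.1).1 h.2⟩
  tfae_have 6 → 5 := fun h =>
    ⟨h.1.2, (isProgenerator_lComod_self_iff h.1.2).2 (similar_of_strict A C h.2).1⟩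
  tfae_have 6 → 7 := fun h =>
    ⟨h.1, (rightTensor_isEquivalence_iff h.1.1).2 h.2.isEquivalence_bimoduleTensor⟩
  tfae_have 7 → 8 := fun h => ⟨h.1, faithfullyFlatLeft_of_isEquivalence _ (LeftDual A C) _
    ((rightTensor_isEquivalence_iff h.1.1).1 h.2)⟩
  tfae_have 8 → 6 := fun h => ⟨h.1, strict_of_faithfullyFlatLeft h.1.1 h.1.2 h.2⟩
  tfae_have 6 → 9 := fun h =>
    ⟨h.1, (leftTensor_isEquivalence_iff h.1.2).2 h.2.isEquivalence_bimoduleTensorLeft⟩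
  tfae_have 9 → 10 := fun h => ⟨h.1, faithfullyFlatRight_of_isEquivalence (RightDual A C) _ _
    ((leftTensor_isEquivalence_iff h.1.2).1 h.2)⟩
  tfae_have 10 → 6 := fun h => ⟨h.1, strict_of_faithfullyFlatRight h.1.1 h.1.2 h.2⟩
  tfae_finish
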